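/- Let $M$ be a smooth, compact Riemannian manifold without boundary, of dimension $d$, and let $\mathfrak{X}^2(M)$ denote the $C^2$ vector fields on $M$. For $u\in\mathfrak{X}^2(M)$ let $f^{(u)}_t$ denote its time-$t$ flow map. For $y\in C^1(M,\mathbb{R})$, $h\in\mathrm{Diff}^1(M,M)$ and $k\in\mathbb{N}$, let $$\Psi^{(k)}_{(y,h)}(x)=\big(y(x),y(h(x)),\dots,y(h^{k-1}(x))\big),\qquad x\in M,$$ be the time-delay map, and let $\boldsymbol{G}$ be the set of all $(y,h)\in C^1(M,\mathbb{R})\times\mathrm{Diff}^1(M,M)$ for which $\Psi^{(2d+1)}_{(y,h)}$ is a $C^1$ embedding of $M$ (this set contains every generic set with the property in Takens' embedding theorem). Let $D^1_+(M)$ be the set of positive $C^1$ functions on $M$ with integral $1$ against the Riemannian volume. A pair $(\rho,h)$ is said to satisfy Assumption 1 if $\rho\in D^1_+(M)$, $h\in\mathrm{Diff}^2(M,M)$ and $(\rho/h_\#\rho,\,h)\in\boldsymbol{G}$, where $(h_\#\rho)(x)=\rho(h^{-1}(x))\,|\det d(h^{-1})_x|$ is the pushforward density. Let $v,w\in\mathfrak{X}^2(M)$,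 let $m>2d+1$, let $\Delta t>0$ and $T\ge m\Delta t$, and put $t_j=j\Delta t$ for $0\le j\le m$. For a vector field $u$ let $\mathcal{L}^{(u)}$ denote, in case (a), the operator $\mathcal{L}^{(u)}[\rho]=\operatorname{div}(\rho u)$ of the continuity equation and, in case (b), the operator $\mathcal{L}^{(u)}[\rho]=\langle\nabla\rho,u\rangle$ of the advection equation. Let $\rho_0:M\to\mathbb{R}$, and for $u\in\{v,w\}$ let $\rho^{(u)}$ be a strong solution of $$\partial_t\rho+\mathcal{L}^{(u)}[\rho]=0,\qquad \rho(0,\cdot)=\rho_0,$$ that is, $\rho^{(u)}$ is continuous on $[0,T]\times M$ and $C^1$ on $(0,T)\times M$, equals $\rho_0$ at $t=0$, and satisfies the equation at every point of $(0,T)\times M$. Assume (a) in the case of the continuity equation, that $(\rho_0,f^{(v)}_{\Delta t})$ satisfies Assumption 1; (b) in the case of the advection equation, that $(\rho_0,f^{(v)}_{\Delta t})\in\boldsymbol{G}$. If $\rho^{(v)}(t_j,x)=\rho^{(w)}(t_j,x)$ for all $x\in M$ and $0\le j\le m$, then $$f^{(v)}_{\Delta t}(x)=f^{(w)}_{\Delta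 t}(x)\qquad\text{for all }x\in M.$$ If, in addition, $\mathcal{L}^{(v)}\big[\rho^{(v)}(t_j,\cdot)\big](x)=\mathcal{L}^{(w)}\big[\rho^{(w)}(t_j,\cdot)\big](x)$ for all $x\in M$ and $0\le j\le m-1$, then $$v(x)=w(x)\qquad\text{for all }x\in M.$$ -/

import Mathlib

open Set MeasureTheory
open scoped Manifold ContDiff Bundle

noncomputable section

namespace SnapshotInversion

variable {d : ℕ} {M : Type*} [TopologicalSpace M] [ChartedSpace (EuclideanSpace ℝ (Fin d)) M]
  [IsManifold (𝓡 d) ∞ M]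

/-- A smooth Riemannian metric on the `d`-dimensional manifold `M`; `g.inner x` is the inner
product on the tangent space at `x`. -/
abbrev Metric (d : ℕ) (M : Type*) [TopologicalSpace M] [ChartedSpace (EuclideanSpace ℝ (Fin d)) M]
    [IsManifold (𝓡 d) ∞ M] :=
  Bundle.ContMDiffRiemannianMetric (𝓡 d) ∞ (EuclideanSpace ℝ (Fin d))
    (fun x : M => TangentSpace (𝓡 d) x)

/-! ### Gradient, volume, Jacobian, divergence -/

/-- The inner product of `g` at `x`, as a bilinear form. -/
def bilin (g : Metric d M) (x : M) : LinearMap.BilinForm ℝ (TangentSpace (𝓡 d) x) :=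
  LinearMap.mk₂ ℝ (fun u w => g.inner x u w) (by simp) (by simp) (by simp) (by simp)

theorem bilin_nondegenerate (g : Metric d M) (x : M) : (bilin g x).Nondegenerate := by
  have key : ∀ u : TangentSpace (𝓡 d) x, g.inner x u u = 0 → u = 0 := fun u hu => by
    by_contra h
    exact (g.pos x u h).ne' hu
  exact ⟨fun u hu => key u (hu u), fun u hu => key u (hu u)⟩

instance (x : M) : FiniteDimensional ℝ (TangentSpace (𝓡 d) x) :=
  inferInstanceAs (FiniteDimensional ℝ (EuclideanSpace ℝ (Fin d)))

/-- The differential of a real function, as a linear form on the tangent space. -/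
def differential (y : M → ℝ) (x : M) : Module.Dual ℝ (TangentSpace (𝓡 d) x) :=
  (mfderiv (𝓡 d) 𝓘(ℝ, ℝ) y x : TangentSpace (𝓡 d) x →L[ℝ] ℝ).toLinearMap

/-- The Riemannian gradient: the tangent vector representing the differential of `y`. -/
def grad (g : Metric d M) (y : M → ℝ) (x : M) : TangentSpace (𝓡 d) x :=
  ((bilin g x).toDual (bilin_nondegenerate g x)).symm (differential y x)

theorem inner_grad (g : Metric d M) (y : M → ℝ) (x : M) (u : TangentSpace (𝓡 d) x) :
    g.inner x (grad g y x) u = differential y x u := by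
  have h := LinearMap.BilinForm.toDual_def (bilin_nondegenerate g x) (m := grad g y x) (n := u)
  rw [grad, LinearEquiv.apply_symm_apply] at h
  exact h.symm

/-- Gram determinant `det (⟨bᵢ, bⱼ⟩ₓ)` of `d` tangent vectors at `x`. -/
def gramDet (g : Metric d M) (x : M) (b : Fin d → TangentSpace (𝓡 d) x) : ℝ :=
  (Matrix.of fun i j => g.inner x (b i) (b j)).det

/-- The `i`-th standard basis vector of `ℝᵈ`. -/
def stdVec (i : Fin d) : EuclideanSpace ℝ (Fin d) := EuclideanSpace.single i 1

/-- The `i`-th coordinate vector field `∂ᵢ` of the preferred chart at `p`, at the point with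
coordinates `z`. -/
def coordVec (p : M) (z : EuclideanSpace ℝ (Fin d)) (i : Fin d) :
    TangentSpace (𝓡 d) ((extChartAt (𝓡 d) p).symm z) :=
  mfderiv 𝓘(ℝ, EuclideanSpace ℝ (Fin d)) (𝓡 d) (extChartAt (𝓡 d) p).symm z (stdVec i)

/-- The local volume density `√(det (gᵢⱼ))` in the preferred chart at `p`. -/
def volDensity (g : Metric d M) (p : M) (z : EuclideanSpace ℝ (Fin d)) : ℝ :=
  Real.sqrt (gramDet g ((extChartAt (𝓡 d) p).symm z) (coordVec p z))

/-- The measure `√(det (gᵢⱼ)) dz¹⋯dzᵈ` of the preferred chart at `p`, carried by its domain. -/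
def chartVolume [MeasurableSpace M] (g : Metric d M) (p : M) : Measure M :=
  ((volume.restrict (extChartAt (𝓡 d) p).target).withDensity
    (fun z => ENNReal.ofReal (volDensity g p z))).map (extChartAt (𝓡 d) p).symm

/-- The Riemannian volume. Each `chartVolume g p` is the restriction of the volume to a chart
domain, and the volume is the least measure above all of them. -/
def riemannianVolume [MeasurableSpace M] (g : Metric d M) : Measure M :=
  ⨆ p : M, chartVolume g p

/-- The absolute value `|det df_x|` of the Jacobian determinant of `f : M → M` at `x`, the
determinant being taken with respect to orthonormal bases of the tangent spaces at `x` and `f x`.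
It equals `√(det ⟨df eᵢ, df eⱼ⟩ / det ⟨eᵢ, eⱼ⟩)` for any basis `e` of the tangent space at `x`. -/
def absJacobian (g : Metric d M) (f : M → M) (x : M) : ℝ :=
  Real.sqrt
    (gramDet g (f x) (fun i => mfderiv (𝓡 d) (𝓡 d) f x (stdVec i : EuclideanSpace ℝ (Fin d))) /
      gramDet g x (fun i => (stdVec i : EuclideanSpace ℝ (Fin d))))

/-- The `i`-th component of the vector field `X` in the preferred chart at `p`. -/
def component (X : ∀ x : M, TangentSpace (𝓡 d) x) (p : M) (i : Fin d)
    (z : EuclideanSpace ℝ (Fin d)) : ℝ :=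
  let Xz : EuclideanSpace ℝ (Fin d) :=
    mfderiv (𝓡 d) 𝓘(ℝ, EuclideanSpace ℝ (Fin d)) (extChartAt (𝓡 d) p)
      ((extChartAt (𝓡 d) p).symm z) (X ((extChartAt (𝓡 d) p).symm z))
  Xz i

/-- The Riemannian divergence, `div X = (1 / √G) ∑ᵢ ∂ᵢ (√G Xⁱ)` with `G = det (gᵢⱼ)`, computed at
`p` in the preferred chart at `p`. -/
def divergence (g : Metric d M) (X : ∀ x : M, TangentSpace (𝓡 d) x) (p : M) : ℝ :=
  (volDensity g p (extChartAt (𝓡 d) p p))⁻¹ *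
    ∑ i : Fin d, fderiv ℝ (fun z => volDensity g p z * component X p i z)
      (extChartAt (𝓡 d) p p) (stdVec i)

/-! ### Densities, diffeomorphisms, flows, delay maps -/

/-- `ρ ∈ D₊¹(M)`: a positive `C¹` probability density with respect to the Riemannian volume. -/
def IsPosDensity [MeasurableSpace M] (g : Metric d M) (ρ : M → ℝ) : Prop :=
  ContMDiff (𝓡 d) 𝓘(ℝ, ℝ) 1 ρ ∧ (∀ x, 0 < ρ x) ∧ ∫ x, ρ x ∂(riemannianVolume g) = 1

/-- The density of the pushforward `f_# ρ`, by the change of variables formula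
`(f_# ρ)(x) = ρ (f⁻¹ x) |det d(f⁻¹)_x|`. -/
def pushforward (g : Metric d M) {n : WithTop ℕ∞} (f : M ≃ₘ^n⟮𝓡 d, 𝓡 d⟯ M) (ρ : M → ℝ) (x : M) :
    ℝ :=
  ρ (f.symm x) * absJacobian g f.symm x

/-- The vector field `v` is of class `Cⁿ`. -/
def IsCVectorField (n : WithTop ℕ∞) (v : ∀ x : M, TangentSpace (𝓡 d) x) : Prop :=
  ContMDiff (𝓡 d) (𝓡 d).tangent n (fun x => (⟨x, v x⟩ : TangentBundle (𝓡 d) M))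

open Classical in
/-- The time-`t` flow map of `v`: `flowMap v t x = γ t`, where `γ : ℝ → M` is the integral curve of
`v` with `γ 0 = x`. (For a `C¹` vector field on a compact manifold it exists and is unique; the
value `x` is a convention for the case that there is none.) -/
def flowMap (v : ∀ x : M, TangentSpace (𝓡 d) x) (t : ℝ) (x : M) : M :=
  if h : ∃ γ : ℝ → M, γ 0 = x ∧ IsMIntegralCurve (I := 𝓡 d) γ v then h.choose t else x

/-- `Y : M → ℝᵏ` is a `C¹` embedding. -/
def IsC1Embedding (d : ℕ) {M : Type*} [TopologicalSpace M]
    [ChartedSpace (EuclideanSpace ℝ (Fin d)) M] {k : ℕ} (Y : M → EuclideanSpace ℝ (Fin k)) :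
    Prop :=
  ContMDiff (𝓡 d) 𝓘(ℝ, EuclideanSpace ℝ (Fin k)) 1 Y ∧ Function.Injective Y ∧
    (∀ x, Function.Injective (mfderiv (𝓡 d) 𝓘(ℝ, EuclideanSpace ℝ (Fin k)) Y x)) ∧
    Topology.IsEmbedding Y

/-- The time-delay map `x ↦ (y x, y (h x), …, y (h^(k-1) x))`. -/
def delayMap {M : Type*} (k : ℕ) (y : M → ℝ) (h : M → M) (x : M) : EuclideanSpace ℝ (Fin k) :=
  WithLp.toLp 2 fun j : Fin k => y (h^[j] x)

/-- The set `G` of pairs `(y, h) ∈ C¹(M, ℝ) × Diff¹(M, M)` for which the `(2d+1)`-dimensional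
time-delay map is an embedding of `M`. It is the largest set with the embedding property, and so
contains every generic set with that property. -/
def takensSet (d : ℕ) (M : Type*) [TopologicalSpace M]
    [ChartedSpace (EuclideanSpace ℝ (Fin d)) M] : Set ((M → ℝ) × (M → M)) :=
  {p | ContMDiff (𝓡 d) 𝓘(ℝ, ℝ) 1 p.1 ∧ (∃ Φ : M ≃ₘ^1⟮𝓡 d, 𝓡 d⟯ M, ⇑Φ = p.2) ∧
    IsC1Embedding d (delayMap (2 * d + 1) p.1 p.2)}

/-- The technical condition on `(ρ, h) ∈ D₊¹(M) × Diff²(M, M)`: `(ρ / h_# ρ, h) ∈ G`. -/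
def SatisfiesAssumption [MeasurableSpace M] (g : Metric d M) (ρ : M → ℝ) (h : M → M) : Prop :=
  IsPosDensity g ρ ∧ ∃ Φ : M ≃ₘ^2⟮𝓡 d, 𝓡 d⟯ M, ⇑Φ = h ∧
    ((fun x => ρ x / pushforward g Φ ρ x), h) ∈ takensSet d M

/-! ### The evolution equations -/

/-- The operator `ρ ↦ div (ρ v)` of the continuity equation. -/
def continuityOp (g : Metric d M) (v : ∀ x : M, TangentSpace (𝓡 d) x) (ρ : M → ℝ) (x : M) : ℝ :=
  divergence g (fun y => ρ y • v y) x

/-- The operator `ρ ↦ ⟨∇ρ, v⟩` of the advection equation. -/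
def advectionOp (g : Metric d M) (v : ∀ x : M, TangentSpace (𝓡 d) x) (ρ : M → ℝ) (x : M) : ℝ :=
  g.inner x (grad g ρ x) (v x)

/-- `ρ` is a strong (classical) solution on `[0, T]` of `∂ₜ ρ + L ρ = 0` with `ρ(0) = ρ₀`:
continuous on `[0, T] × M`, continuously differentiable on `(0, T) × M`, and satisfying the
equation at every point of `(0, T) × M`. -/
def IsStrongSolution (d : ℕ) {M : Type*} [TopologicalSpace M]
    [ChartedSpace (EuclideanSpace ℝ (Fin d)) M] (L : (M → ℝ) → M → ℝ) (T : ℝ) (ρ₀ : M → ℝ)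
    (ρ : ℝ → M → ℝ) : Prop :=
  ContinuousOn (fun q : ℝ × M => ρ q.1 q.2) (Icc 0 T ×ˢ univ) ∧
    ContMDiffOn (𝓘(ℝ, ℝ).prod (𝓡 d)) 𝓘(ℝ, ℝ) 1 (fun q : ℝ × M => ρ q.1 q.2) (Ioo 0 T ×ˢ univ) ∧
    (∀ x, ρ 0 x = ρ₀ x) ∧
    ∀ t ∈ Ioo 0 T, ∀ x, deriv (fun s => ρ s x) t + L (ρ t) x = 0

end SnapshotInversion

end

namespace SnapshotInversion

open Filter Topology

/-! ### Calculus: the determinant near the identity, and local flows -/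

/-! Write `f_t` for the flow of `v` and `y` for a scalar observable. In both cases the snapshots of
the solution reveal `y ∘ f_{-jΔt}` for j = 0, …, 2d+1. After precomposition with `f_{-2dΔt}`, the
2d+1 delay coordinates of `y` are exactly such functions, and the delay map of the pair (y, `f_Δt`)
is an injective immersion. Injectivity turns equality of the snapshots into equality of the flow
maps (`flowMap_eq_of_delay`). Injectivity of the differential turns the equations `d(y ∘ f_{-jΔt})(v
- w) = 0` into `v = w` (`eq_zero_of_delay`).

For advection, ρ is constant along characteristics, so `y = ρ₀` works directly
(`advection_apply_flowMap`), and the equations for `v - w` are the equality of the operators.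

For the continuity equation the density is divided by a Jacobian as it is transported. By
Liouville's formula (`hasDerivAt_volStretch`), ρ times the transported volume is constant along
characteristics (`mul_volStretch`). Comparing two starting times cancels the Jacobian
(`mul_eq_mul`): the quotient of consecutive snapshots is advected, `ρ(jΔt)/ρ((j+1)Δt) = y ∘
f_{-jΔt}` with `y = ρ₀/ρ(Δt)`, and `ρ(Δt)` is the pushforward of ρ₀ (`eq_pushforward`). The
operators give `ρ (div v - div w) + dρ(v - w) = 0` at each snapshot; the unknown divergences are
eliminated between consecutive times.

Liouville's formula needs the flow to be differentiable in the initial point, with a differential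
solving the linearised equation. This is proved in charts by Picard–Lindelöf and Grönwall. -/

theorem hasDerivAt_det_of_eq_one {n : Type*} [Fintype n] [DecidableEq n] {A : ℝ → Matrix n n ℝ}
    {A' : Matrix n n ℝ} {t : ℝ} (hA : ∀ i j, HasDerivAt (fun s => A s i j) (A' i j) t)
    (h1 : A t = 1) : HasDerivAt (fun s => (A s).det) A'.trace t := by
  simp only [Matrix.det_apply]
  have key := HasDerivAt.fun_sum (u := Finset.univ) fun (σ : Equiv.Perm n) _ =>
    (HasDerivAt.fun_finsetProd (u := Finset.univ) fun i _ => hA (σ i) i).const_smul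
      (Equiv.Perm.sign σ)
  refine key.congr_deriv ?_
  rw [Finset.sum_eq_single (1 : Equiv.Perm n)]
  · simp only [Equiv.Perm.sign_one, one_smul, Equiv.Perm.one_apply, h1, Matrix.one_apply_eq,
      Finset.prod_const_one]
    rfl
  · intro σ _ hσ
    rw [Finset.sum_eq_zero, smul_zero]
    intro i _
    -- A nonidentity permutation moves at least two indices, so after one factor is differentiated
    -- an off-diagonal factor of the identity matrix remains and kills the term.
    obtain ⟨j, hji, hj⟩ : ∃ j, j ≠ i ∧ σ j ≠ j := by
      by_contra! hcon
      apply hσ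
      ext k
      by_cases hk : k = i
      · subst hk
        by_contra hne
        exact hne (σ.injective (hcon _ hne))
      · exact hcon k hk
    rw [Finset.prod_eq_zero (i := j) (by simp [hji]), zero_smul]
    rw [h1, Matrix.one_apply_ne hj]
  · simp

/-- Linearity in the defect is what makes a quadratic defect yield a quadratic error. -/
theorem gronwallBound_zero_eq_mul (K η x : ℝ) :
    gronwallBound 0 K η x = η * gronwallBound 0 K 1 x := by
  unfold gronwallBound
  split_ifs <;> ring

section LocalFlow

variable {E : Type*} [NormedAddCommGroup E] [NormedSpace ℝ E]

theorem norm_sub_le_of_approx_trajectory {V : E → E} {K : NNReal} {B : Set E}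
    (hV : LipschitzOnWith K V B) {ε η : ℝ} {f g g' : ℝ → E}
    (hf : ∀ t ∈ Ioo (-ε) ε, HasDerivAt f (V (f t)) t ∧ f t ∈ B)
    (hg : ∀ t ∈ Ioo (-ε) ε, HasDerivAt g (g' t) t ∧ g t ∈ B ∧ ‖g' t - V (g t)‖ ≤ η)
    (h0 : f 0 = g 0) {t : ℝ} (ht : t ∈ Ioo (-ε) ε) :
    ‖f t - g t‖ ≤ η * gronwallBound 0 K 1 |t| := by
  wlog h : 0 ≤ t generalizing f g g' V t
  · have hmem : ∀ s ∈ Ioo (-ε) ε, -s ∈ Ioo (-ε) ε := fun s hs =>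
      ⟨by linarith [hs.2], by linarith [hs.1]⟩
    have := this (V := fun x => -V x) (f := fun s => f (-s)) (g := fun s => g (-s))
      (g' := fun s => -g' (-s)) (t := -t) hV.neg
      (fun s hs => ⟨by
        simpa [Function.comp_def] using (hf _ (hmem s hs)).1.scomp s (hasDerivAt_neg s), (hf _ (hmem s hs)).2⟩)
      (fun s hs => ⟨by
        simpa [Function.comp_def] using (hg _ (hmem s hs)).1.scomp s (hasDerivAt_neg s), (hg _ (hmem s hs)).2.1, by
        rw [← neg_sub_neg, neg_neg, neg_neg, norm_sub_rev, norm_sub_rev]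
        rw [← norm_neg]
        simpa [neg_add_eq_sub] using (hg _ (hmem s hs)).2.2⟩)
      (by simpa using h0) (hmem t ht) (by linarith)
    simpa using this
  · have hsub : ∀ s ∈ Icc 0 t, s ∈ Ioo (-ε) ε := fun s hs =>
      ⟨by linarith [hs.1, ht.1, ht.2], by linarith [hs.2, ht.2]⟩
    have hsub' : ∀ s ∈ Ico 0 t, s ∈ Ioo (-ε) ε := fun s hs => hsub s (Ico_subset_Icc_self hs)
    have := dist_le_of_approx_trajectories_ODE_of_mem (v := fun _ => V) (s := fun _ => B)
      (f := f) (g := g) (f' := fun s => V (f s)) (g' := g') (a := 0) (b := t) (εf := 0) (εg := η)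
      (δ := 0) (K := K) (fun _ _ => hV)
      (fun s hs => (hf s (hsub s hs)).1.continuousAt.continuousWithinAt)
      (fun s hs => (hf s (hsub' s hs)).1.hasDerivWithinAt) (fun s _ => by simp)
      (fun s hs => (hf s (hsub' s hs)).2)
      (fun s hs => (hg s (hsub s hs)).1.continuousAt.continuousWithinAt)
      (fun s hs => (hg s (hsub' s hs)).1.hasDerivWithinAt)
      (fun s hs => by rw [dist_eq_norm]; exact (hg s (hsub' s hs)).2.2)
      (fun s hs => (hg s (hsub' s hs)).2.1) (by simp [h0]) t ⟨h, le_rfl⟩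
    rw [dist_eq_norm, zero_add, sub_zero, gronwallBound_zero_eq_mul] at this
    rwa [abs_of_nonneg h]

/-- Mean value inequality on the segment, where the derivative differs from its value at `a` by at
most `K * ‖b - a‖`. -/
theorem norm_sub_sub_fderiv_le_sq {V : E → E} {K : NNReal} {B : Set E} (hB : Convex ℝ B)
    (hd : ∀ z ∈ B, DifferentiableAt ℝ V z) (hK : LipschitzOnWith K (fderiv ℝ V) B)
    {a b : E} (ha : a ∈ B) (hb : b ∈ B) :
    ‖V b - V a - fderiv ℝ V a (b - a)‖ ≤ K * ‖b - a‖ ^ 2 := by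
  have hs : segment ℝ a b ⊆ B := hB.segment_subset ha hb
  have := Convex.norm_image_sub_le_of_norm_hasFDerivWithin_le' (f := V) (f' := fderiv ℝ V)
    (φ := fderiv ℝ V a) (C := K * ‖b - a‖) (s := segment ℝ a b)
    (fun x hx => (hd x (hs hx)).hasFDerivAt.hasFDerivWithinAt)
    (fun x hx => (hK.norm_sub_le (hs hx) ha).trans <| by
      gcongr
      obtain ⟨θ, hθ, rfl⟩ := (segment_eq_image' ℝ a b ▸ hx :)
      simp only [add_sub_cancel_left, norm_smul, Real.norm_eq_abs, abs_of_nonneg hθ.1]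
      exact mul_le_of_le_one_left (norm_nonneg _) hθ.2)
    (convex_segment a b) (left_mem_segment ℝ a b) (right_mem_segment ℝ a b)
  rw [sq, ← mul_assoc]
  exact this

/-- A `C²` vector field has a local flow `F` which is differentiable in the initial point, with a
differential `Y` solving the linearised equation. -/
theorem exists_local_flow [CompleteSpace E] {V : E → E} {z₀ : E} (hV : ContDiffAt ℝ 2 V z₀)
    {U : Set E} (hU : U ∈ 𝓝 z₀) :
    ∃ r > 0, ∃ ε > 0, ∃ (F : E → ℝ → E) (Y : E → ℝ → E →L[ℝ] E), ∀ q ∈ Metric.ball z₀ r,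
      F q 0 = q ∧ Y q 0 = 1 ∧ ∀ t ∈ Ioo (-ε) ε, F q t ∈ U ∧ HasDerivAt (F q) (V (F q t)) t ∧
        HasDerivAt (Y q) (fderiv ℝ V (F q t) ∘L Y q t) t ∧
        HasFDerivAt (fun q' => F q' t) (Y q t) q := by
  obtain ⟨K, s, hs, hK⟩ := (hV.of_le one_le_two).exists_lipschitzOnWith
  have hDV : ContDiffAt ℝ 1 (fderiv ℝ V) z₀ := hV.fderiv_right (by norm_num)
  obtain ⟨K', s', hs', hK'⟩ := hDV.exists_lipschitzOnWith
  have hdiff : ∀ᶠ z in 𝓝 z₀, DifferentiableAt ℝ V z :=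
    (hV.eventually (by simp)).mono fun z hz => hz.differentiableAt (by simp)
  obtain ⟨δ, hδ, hball⟩ := Metric.mem_nhds_iff.1 (inter_mem (inter_mem hs hs') (inter_mem hU hdiff))
  -- The equation and its linearisation are solved as one system for (F, Y). Its right-hand side is
  -- C¹ because `V` is C².
  have hW : ContDiffAt ℝ 1 (fun p : E × (E →L[ℝ] E) => (V p.1, fderiv ℝ V p.1 ∘L p.2)) (z₀, 1) :=
    ((hV.of_le one_le_two).comp (z₀, (1 : E →L[ℝ] E)) contDiffAt_fst).prodMk
      ((hDV.comp (z₀, (1 : E →L[ℝ] E)) contDiffAt_fst).clm_comp contDiffAt_snd)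
  obtain ⟨ε₁, hε₁, a, r₁, L, K₁, hr₁, hPL⟩ := IsPicardLindelof.of_contDiffAt_one hW
  obtain ⟨α, hα, hcont⟩ := (hPL 0).exists_forall_mem_closedBall_eq_hasDerivWithinAt_continuousOn
  simp only [zero_sub, zero_add] at hα hcont
  have hr₁' : (0 : ℝ) < r₁ := hr₁
  have hα0 : α ((z₀, 1), 0) = (z₀, 1) := (hα _ (Metric.mem_closedBall_self hr₁'.le)).1
  have hcontAt : ContinuousAt α ((z₀, 1), 0) := hcont.continuousAt
    (prod_mem_nhds (Metric.closedBall_mem_nhds _ hr₁') (Icc_mem_nhds (by linarith) hε₁))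
  -- The radii leave room for linear perturbations: `‖Y‖ ≤ 2`, so for `‖ξ‖ < δ / 4` the curve `F q +
  -- Y q ξ` stays in the ball of radius `δ`, where the Lipschitz bounds hold.
  have hN : Metric.ball z₀ (δ / 2) ×ˢ Metric.ball (1 : E →L[ℝ] E) 1 ∈ 𝓝 (α ((z₀, 1), 0)) := by
    rw [hα0]
    exact prod_mem_nhds (Metric.ball_mem_nhds _ (half_pos hδ)) (Metric.ball_mem_nhds _ one_pos)
  obtain ⟨r₂, hr₂, hr₂'⟩ := Metric.mem_nhds_iff.1 (hcontAt hN)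
  set r := min (r₁ : ℝ) r₂ with hr
  set ε := min ε₁ r₂ with hε
  have hrpos : 0 < r := lt_min hr₁' hr₂
  have hεpos : 0 < ε := lt_min hε₁ hr₂
  set F : E → ℝ → E := fun q t => (α ((q, 1), t)).1 with hF
  set Y : E → ℝ → E →L[ℝ] E := fun q t => (α ((q, 1), t)).2 with hY
  have hmem : ∀ q ∈ Metric.ball z₀ r, (q, (1 : E →L[ℝ] E)) ∈ Metric.closedBall (z₀, 1) (r₁ : ℝ) := by
    intro q hq
    rw [Metric.mem_closedBall, Prod.dist_eq]
    simpa using (Metric.mem_ball.1 hq).le.trans (min_le_left _ _)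
  have h0 : ∀ q ∈ Metric.ball z₀ r, F q 0 = q ∧ Y q 0 = 1 := fun q hq => by
    have := (hα _ (hmem q hq)).1
    simp only [hF, hY, this, and_self]
  have hin : ∀ q ∈ Metric.ball z₀ r, ∀ t ∈ Ioo (-ε) ε,
      F q t ∈ Metric.ball z₀ (δ / 2) ∧ Y q t ∈ Metric.ball (1 : E →L[ℝ] E) 1 := by
    intro q hq t ht
    refine (hr₂' (?_ : ((q, (1 : E →L[ℝ] E)), t) ∈ _) :)
    rw [Metric.mem_ball, Prod.dist_eq, Prod.dist_eq]
    simp only [dist_self, Real.dist_eq, sub_zero]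
    refine max_lt (max_lt ?_ hr₂) ?_
    · exact (Metric.mem_ball.1 hq).trans_le (min_le_right _ _)
    · exact (abs_lt.2 ht).trans_le (min_le_right _ _)
  have hderiv : ∀ q ∈ Metric.ball z₀ r, ∀ t ∈ Ioo (-ε) ε, HasDerivAt (F q) (V (F q t)) t ∧
      HasDerivAt (Y q) (fderiv ℝ V (F q t) ∘L Y q t) t := by
    intro q hq t ht
    have ht1 : -ε₁ < t := by linarith [ht.1, min_le_left ε₁ r₂]
    have ht2 : t < ε₁ := by linarith [ht.2, min_le_left ε₁ r₂]
    have := ((hα _ (hmem q hq)).2 t ⟨ht1.le, ht2.le⟩).hasDerivAt (Icc_mem_nhds ht1 ht2)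
    have h2 := this.hasFDerivAt
    exact ⟨by simpa using h2.fst.hasDerivAt, by simpa using h2.snd.hasDerivAt⟩
  have hhalf : Metric.ball z₀ (δ / 2) ⊆ Metric.ball z₀ δ :=
    Metric.ball_subset_ball (by linarith)
  refine ⟨r, hrpos, ε, hεpos, F, Y, fun q hq => ⟨(h0 q hq).1, (h0 q hq).2, fun t ht =>
    ⟨(hball (hhalf (hin q hq t ht).1)).2.1, (hderiv q hq t ht).1, (hderiv q hq t ht).2, ?_⟩⟩⟩
  have hYle : ∀ t ∈ Ioo (-ε) ε, ‖Y q t‖ ≤ 2 := fun t ht => by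
    have h1 := (hin q hq t ht).2
    rw [mem_ball_iff_norm] at h1
    calc ‖Y q t‖ = ‖(Y q t - 1) + 1‖ := by rw [sub_add_cancel]
      _ ≤ ‖Y q t - 1‖ + ‖(1 : E →L[ℝ] E)‖ := norm_add_le _ _
      _ ≤ 1 + 1 := add_le_add h1.le ContinuousLinearMap.norm_id_le
      _ = 2 := by norm_num
  rw [hasFDerivAt_iff_isLittleO_nhds_zero]
  -- The curve `F q + Y q ξ` solves the equation up to the Taylor remainder `K' * (2 * ‖ξ‖) ^ 2`, so
  -- by Grönwall it is that close, up to a factor, to the true trajectory from `q + ξ`.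
  have hbound : ∀ᶠ ξ in 𝓝 (0 : E), ‖F (q + ξ) t - F q t - Y q t ξ‖ ≤
      (K' * 4 * gronwallBound 0 K 1 |t|) * ‖ξ‖ ^ 2 := by
    have e1 : ∀ᶠ ξ in 𝓝 (0 : E), q + ξ ∈ Metric.ball z₀ r := by
      have : Tendsto (fun ξ : E => q + ξ) (𝓝 0) (𝓝 q) :=
        Continuous.tendsto' (by fun_prop) _ _ (by simp)
      exact this (Metric.isOpen_ball.mem_nhds hq)
    have e2 : ∀ᶠ ξ in 𝓝 (0 : E), ‖ξ‖ < δ / 4 := by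
      filter_upwards [Metric.ball_mem_nhds (0 : E) (show 0 < δ / 4 by linarith)] with ξ hξ
      simpa using hξ
    filter_upwards [e1, e2] with ξ hξ1 hξ2
    have hYξ : ∀ s ∈ Ioo (-ε) ε, ‖Y q s ξ‖ ≤ 2 * ‖ξ‖ := fun s hs =>
      (Y q s).le_of_opNorm_le (hYle s hs) ξ
    have hg : ∀ s ∈ Ioo (-ε) ε, F q s + Y q s ξ ∈ Metric.ball z₀ δ := fun s hs => by
      have h1 := (hin q hq s hs).1
      rw [mem_ball_iff_norm] at h1 ⊢
      calc ‖F q s + Y q s ξ - z₀‖ = ‖(F q s - z₀) + Y q s ξ‖ := by congr 1; abel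
        _ ≤ ‖F q s - z₀‖ + ‖Y q s ξ‖ := norm_add_le _ _
        _ < δ := by linarith [hYξ s hs]
    have := norm_sub_le_of_approx_trajectory (V := V) (K := K) (B := Metric.ball z₀ δ)
      (hK.mono fun x hx => (hball hx).1.1) (ε := ε) (η := K' * (2 * ‖ξ‖) ^ 2)
      (f := F (q + ξ)) (g := fun s => F q s + Y q s ξ)
      (g' := fun s => V (F q s) + fderiv ℝ V (F q s) (Y q s ξ))
      (fun s hs => ⟨(hderiv _ hξ1 s hs).1, hhalf (hin _ hξ1 s hs).1⟩)
      (fun s hs => ⟨(hderiv q hq s hs).1.add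
          (by simpa using (hderiv q hq s hs).2.clm_apply (hasDerivAt_const s ξ)), hg s hs, ?_⟩)
      (by simp [(h0 _ hξ1).1, (h0 _ hq).1, (h0 _ hq).2]) ht
    · rw [← sub_sub] at this
      refine this.trans (le_of_eq ?_)
      ring
    · have h2 := norm_sub_sub_fderiv_le_sq (convex_ball z₀ δ) (fun z hz => (hball hz).2.2)
        (hK'.mono fun x hx => (hball hx).1.2) (hhalf (hin q hq s hs).1) (hg s hs)
      rw [add_sub_cancel_left] at h2
      rw [norm_sub_rev, ← sub_sub]
      refine h2.trans ?_
      gcongr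
      exact hYξ s hs
  refine Asymptotics.IsBigO.trans_isLittleO (g := fun ξ : E => ‖ξ‖ ^ 2) ?_ ?_
  · refine Asymptotics.IsBigO.of_bound (K' * 4 * gronwallBound 0 K 1 |t|) ?_
    filter_upwards [hbound] with ξ hξ
    simpa using hξ
  · exact Asymptotics.isLittleO_norm_pow_id one_lt_two

end LocalFlow

noncomputable section

variable {d : ℕ} {M : Type*} [TopologicalSpace M] [ChartedSpace (EuclideanSpace ℝ (Fin d)) M]
  [IsManifold (𝓡 d) ∞ M]

/-! ### The preferred chart and its differential -/

omit [IsManifold (𝓡 d) ∞ M] in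
theorem extChartAt_target_mem_nhds_of_mem {p : M} {z : EuclideanSpace ℝ (Fin d)}
    (hz : z ∈ (extChartAt (𝓡 d) p).target) : (extChartAt (𝓡 d) p).target ∈ 𝓝 z :=
  (isOpen_extChartAt_target p).mem_nhds hz

/-- The differential at `x` of the preferred chart at `p`. -/
def chartDeriv (p x : M) : EuclideanSpace ℝ (Fin d) →L[ℝ] EuclideanSpace ℝ (Fin d) :=
  mfderiv (𝓡 d) 𝓘(ℝ, EuclideanSpace ℝ (Fin d)) (extChartAt (𝓡 d) p) x

/-- The differential at `z` of the inverse of the preferred chart at `p`. -/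
def chartSymmDeriv (p : M) (z : EuclideanSpace ℝ (Fin d)) :
    EuclideanSpace ℝ (Fin d) →L[ℝ] EuclideanSpace ℝ (Fin d) :=
  mfderiv 𝓘(ℝ, EuclideanSpace ℝ (Fin d)) (𝓡 d) (extChartAt (𝓡 d) p).symm z

theorem isManifold_one : IsManifold (𝓡 d) 1 M := IsManifold.of_le (n := ∞) (by simp)

theorem hasMFDerivAt_chart {p x : M} (hx : x ∈ (extChartAt (𝓡 d) p).source) :
    HasMFDerivAt (𝓡 d) 𝓘(ℝ, EuclideanSpace ℝ (Fin d)) (extChartAt (𝓡 d) p) x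
      (chartDeriv p x) := by
  have : IsManifold (𝓡 d) 1 M := isManifold_one
  exact (mdifferentiableAt_extChartAt (extChartAt_source (𝓡 d) p ▸ hx)).hasMFDerivAt

theorem hasMFDerivAt_chart_symm {p : M} {z : EuclideanSpace ℝ (Fin d)}
    (hz : z ∈ (extChartAt (𝓡 d) p).target) :
    HasMFDerivAt 𝓘(ℝ, EuclideanSpace ℝ (Fin d)) (𝓡 d) (extChartAt (𝓡 d) p).symm z
      (chartSymmDeriv p z) := by
  have : IsManifold (𝓡 d) 1 M := isManifold_one
  exact ((mdifferentiableOn_extChartAt_symm z hz).mdifferentiableAt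
    (extChartAt_target_mem_nhds_of_mem hz)).hasMFDerivAt

theorem chartDeriv_chartSymmDeriv {p : M} {z : EuclideanSpace ℝ (Fin d)}
    (hz : z ∈ (extChartAt (𝓡 d) p).target) (u : EuclideanSpace ℝ (Fin d)) :
    chartDeriv p ((extChartAt (𝓡 d) p).symm z) (chartSymmDeriv p z u) = u := by
  have : IsManifold (𝓡 d) 1 M := isManifold_one
  have := mfderiv_extChartAt_comp_mfderivWithin_extChartAt_symm (I := 𝓡 d) hz
  rw [(𝓡 d).range_eq_univ, mfderivWithin_univ] at this
  exact DFunLike.congr_fun this u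

theorem chartSymmDeriv_chartDeriv {p : M} {z : EuclideanSpace ℝ (Fin d)}
    (hz : z ∈ (extChartAt (𝓡 d) p).target) (u : EuclideanSpace ℝ (Fin d)) :
    chartSymmDeriv p z (chartDeriv p ((extChartAt (𝓡 d) p).symm z) u) = u := by
  have : IsManifold (𝓡 d) 1 M := isManifold_one
  have := mfderivWithin_extChartAt_symm_comp_mfderiv_extChartAt (I := 𝓡 d) hz
  rw [(𝓡 d).range_eq_univ, mfderivWithin_univ] at this
  exact DFunLike.congr_fun this u

/-- The vector field `v` in the preferred chart at `p`. -/
def chartField (v : ∀ x : M, TangentSpace (𝓡 d) x) (p : M) (z : EuclideanSpace ℝ (Fin d)) :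
    EuclideanSpace ℝ (Fin d) :=
  chartDeriv p ((extChartAt (𝓡 d) p).symm z) (v ((extChartAt (𝓡 d) p).symm z))

/-- Near `p` the tangent bundle trivialization at `p` is the differential of the chart at `p`, so
regularity of a section is that of its chart expression. -/
theorem contMDiffAt_chartDeriv_apply {n : WithTop ℕ∞} {v : ∀ x : M, TangentSpace (𝓡 d) x} {p : M} :
    ContMDiffAt (𝓡 d) (𝓡 d).tangent n (fun x => (⟨x, v x⟩ : TangentBundle (𝓡 d) M)) p ↔
    ContMDiffAt (𝓡 d) 𝓘(ℝ, EuclideanSpace ℝ (Fin d)) n (fun x => chartDeriv p x (v x)) p := by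
  have : IsManifold (𝓡 d) 1 M := isManifold_one
  refine (Bundle.contMDiffAt_section p).trans (Filter.EventuallyEq.contMDiffAt_iff ?_)
  filter_upwards [(chartAt (EuclideanSpace ℝ (Fin d)) p).open_source.mem_nhds (mem_chart_source _ p)]
    with x hx
  have := TangentBundle.continuousLinearMapAt_trivializationAt (I := 𝓡 d) (𝕜 := ℝ) hx
  have h2 : (trivializationAt (EuclideanSpace ℝ (Fin d)) (TangentSpace (𝓡 d)) p).continuousLinearMapAt
      ℝ x (v x) = (trivializationAt (EuclideanSpace ℝ (Fin d)) (TangentSpace (𝓡 d)) p ⟨x, v x⟩).2 := by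
    rw [Bundle.Trivialization.continuousLinearMapAt_apply,
      Bundle.Trivialization.coe_linearMapAt_of_mem]
    simpa using hx
  exact h2.symm.trans (DFunLike.congr_fun this (v x))

theorem contDiffAt_chartField {n : WithTop ℕ∞} (hn : n ≤ ∞) {v : ∀ x : M, TangentSpace (𝓡 d) x}
    (hv : IsCVectorField n v) (p : M) :
    ContDiffAt ℝ n (chartField v p) (extChartAt (𝓡 d) p p) := by
  rw [← contMDiffAt_iff_contDiffAt]
  have : IsManifold (𝓡 d) n M := IsManifold.of_le hn
  have h := contMDiffAt_chartDeriv_apply.1 (hv p)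
  have h2 : ContMDiffAt 𝓘(ℝ, EuclideanSpace ℝ (Fin d)) (𝓡 d) n (extChartAt (𝓡 d) p).symm
      (extChartAt (𝓡 d) p p) :=
    (contMDiffOn_extChartAt_symm p).contMDiffAt (extChartAt_target_mem_nhds p)
  exact ContMDiffAt.comp_of_eq h h2 (extChartAt_to_inv p)

theorem hasMFDerivAt_chart_symm_comp {v : ∀ x : M, TangentSpace (𝓡 d) x} {p : M}
    {F : ℝ → EuclideanSpace ℝ (Fin d)} {t : ℝ} (hF : HasDerivAt F (chartField v p (F t)) t)
    (ht : F t ∈ (extChartAt (𝓡 d) p).target) :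
    HasMFDerivAt 𝓘(ℝ, ℝ) (𝓡 d) ((extChartAt (𝓡 d) p).symm ∘ F) t
      ((1 : ℝ →L[ℝ] ℝ).smulRight (v ((extChartAt (𝓡 d) p).symm (F t)))) := by
  refine ((hasMFDerivAt_chart_symm ht).comp t hF.hasFDerivAt.hasMFDerivAt).congr_mfderiv ?_
  ext
  exact (congrArg _ (one_smul ℝ _)).trans
    ((chartSymmDeriv_chartDeriv ht _).trans (one_smul ℝ _).symm)

/-! ### The flow of a vector field on a compact manifold -/

section Flow

variable {v : ∀ x : M, TangentSpace (𝓡 d) x}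

/-- Local flow of `v` in the preferred chart at `p`. -/
theorem exists_chart_flow (hv : IsCVectorField 2 v) (p : M) :
    ∃ W ∈ 𝓝 p, W ⊆ (extChartAt (𝓡 d) p).source ∧ ∃ ε > 0,
      ∃ (F : EuclideanSpace ℝ (Fin d) → ℝ → EuclideanSpace ℝ (Fin d))
        (Y : EuclideanSpace ℝ (Fin d) → ℝ →
          EuclideanSpace ℝ (Fin d) →L[ℝ] EuclideanSpace ℝ (Fin d)),
      ∀ x ∈ W, F (extChartAt (𝓡 d) p x) 0 = extChartAt (𝓡 d) p x ∧
        Y (extChartAt (𝓡 d) p x) 0 = 1 ∧ ∀ t ∈ Ioo (-ε) ε,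
        F (extChartAt (𝓡 d) p x) t ∈ (extChartAt (𝓡 d) p).target ∧
        HasDerivAt (F (extChartAt (𝓡 d) p x))
          (chartField v p (F (extChartAt (𝓡 d) p x) t)) t ∧
        HasDerivAt (Y (extChartAt (𝓡 d) p x))
          (fderiv ℝ (chartField v p) (F (extChartAt (𝓡 d) p x) t) ∘L
            Y (extChartAt (𝓡 d) p x) t) t ∧
        HasFDerivAt (fun z => F z t) (Y (extChartAt (𝓡 d) p x) t) (extChartAt (𝓡 d) p x) := by
  obtain ⟨r, hr, ε, hε, F, Y, h⟩ := exists_local_flow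
    (contDiffAt_chartField (by norm_cast) hv p) (extChartAt_target_mem_nhds p)
  refine ⟨(extChartAt (𝓡 d) p).source ∩ extChartAt (𝓡 d) p ⁻¹' Metric.ball _ r, inter_mem
    (extChartAt_source_mem_nhds p)
    ((continuousAt_extChartAt p).preimage_mem_nhds (Metric.ball_mem_nhds _ hr)),
    inter_subset_left, ε, hε, F, Y, fun x hx => h _ hx.2⟩

theorem IsCVectorField.of_le {m n : WithTop ℕ∞} (hv : IsCVectorField n v) (h : m ≤ n) :
    IsCVectorField m v := ContMDiff.of_le hv h

variable [CompactSpace M] [T2Space M]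

/-- Compactness gives a common existence time for all initial points, and local curves with a
uniform existence time extend to the whole line. -/
theorem exists_isMIntegralCurve (hv : IsCVectorField 2 v) (x : M) :
    ∃ γ : ℝ → M, γ 0 = x ∧ IsMIntegralCurve (I := 𝓡 d) γ v := by
  have : IsManifold (𝓡 d) 1 M := isManifold_one
  choose W hW hWs ε hε F Y h using exists_chart_flow hv
  obtain ⟨s, -, hs⟩ := isCompact_univ.elim_nhds_subcover W fun p _ => hW p
  obtain ⟨ε₀, hε₀, hle⟩ : ∃ ε₀ > 0, ∀ p ∈ s, ε₀ ≤ ε p := by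
    rcases s.eq_empty_or_nonempty with rfl | hne
    · exact ⟨1, one_pos, by simp⟩
    · obtain ⟨p, hp, hmin⟩ := s.exists_min_image ε hne
      exact ⟨ε p, hε p, hmin⟩
  refine exists_isMIntegralCurve_of_isMIntegralCurveOn (hv.of_le one_le_two) hε₀ (fun y => ?_) x
  obtain ⟨p, hp, hy⟩ : ∃ p ∈ s, y ∈ W p := by simpa using hs (mem_univ y)
  obtain ⟨h0, -, hF⟩ := h p y hy
  refine ⟨(extChartAt (𝓡 d) p).symm ∘ F p (extChartAt (𝓡 d) p y), ?_, fun t ht => ?_⟩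
  · rw [Function.comp_apply, h0, (extChartAt (𝓡 d) p).left_inv (hWs p hy)]
  · obtain ⟨h1, h2, -⟩ := hF t ⟨by linarith [ht.1, hle p hp], by linarith [ht.2, hle p hp]⟩
    exact (hasMFDerivAt_chart_symm_comp h2 h1).hasMFDerivWithinAt

theorem isMIntegralCurve_flowMap (hv : IsCVectorField 2 v) (x : M) :
    IsMIntegralCurve (I := 𝓡 d) (fun t => flowMap v t x) v := by
  have h := exists_isMIntegralCurve hv x
  -- The choice in `flowMap` depends on `x` only, so a single curve serves all times.
  have : (fun t => flowMap v t x) = h.choose := by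
    funext t
    rw [flowMap, dif_pos h]
  rw [this]
  exact h.choose_spec.2

theorem flowMap_zero (hv : IsCVectorField 2 v) (x : M) : flowMap v 0 x = x := by
  have h := exists_isMIntegralCurve hv x
  rw [flowMap, dif_pos h]
  exact h.choose_spec.1

theorem flowMap_eq_of_isMIntegralCurve (hv : IsCVectorField 2 v) {γ : ℝ → M}
    (hγ : IsMIntegralCurve (I := 𝓡 d) γ v) (t : ℝ) : flowMap v t (γ 0) = γ t := by
  have : IsManifold (𝓡 d) 1 M := isManifold_one
  exact congrFun (isMIntegralCurve_Ioo_eq_of_contMDiff_boundaryless (t₀ := 0)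
    (hv.of_le one_le_two) (isMIntegralCurve_flowMap hv (γ 0)) hγ (flowMap_zero hv _)) t

theorem flowMap_eq_of_isMIntegralCurveOn (hv : IsCVectorField 2 v) {γ : ℝ → M} {ε t : ℝ}
    (hγ : IsMIntegralCurveOn (I := 𝓡 d) γ v (Ioo (-ε) ε)) (ht : t ∈ Ioo (-ε) ε) :
    flowMap v t (γ 0) = γ t := by
  have : IsManifold (𝓡 d) 1 M := isManifold_one
  have h0 : (0 : ℝ) ∈ Ioo (-ε) ε := ⟨by linarith [ht.1, ht.2], by linarith [ht.1, ht.2]⟩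
  exact isMIntegralCurveOn_Ioo_eqOn_of_contMDiff_boundaryless h0 (hv.of_le one_le_two)
    ((isMIntegralCurve_flowMap hv (γ 0)).isMIntegralCurveOn _) hγ (flowMap_zero hv _) ht

theorem flowMap_add (hv : IsCVectorField 2 v) (s t : ℝ) (x : M) :
    flowMap v (s + t) x = flowMap v s (flowMap v t x) := by
  have := flowMap_eq_of_isMIntegralCurve hv ((isMIntegralCurve_flowMap hv x).comp_add t) s
  simpa using this.symm

/-- In the preferred chart at `p` the flow is differentiable in the initial point, and its
differential solves the linearised equation. -/
theorem exists_chart_flowMap (hv : IsCVectorField 2 v) (p : M) :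
    ∃ W ∈ 𝓝 p, ∃ ε > 0,
      ∃ (F : EuclideanSpace ℝ (Fin d) → ℝ → EuclideanSpace ℝ (Fin d))
        (Y : EuclideanSpace ℝ (Fin d) → ℝ →
          EuclideanSpace ℝ (Fin d) →L[ℝ] EuclideanSpace ℝ (Fin d)),
      ∀ x ∈ W, F (extChartAt (𝓡 d) p x) 0 = extChartAt (𝓡 d) p x ∧
        Y (extChartAt (𝓡 d) p x) 0 = 1 ∧ ∀ t ∈ Ioo (-ε) ε,
        flowMap v t x = (extChartAt (𝓡 d) p).symm (F (extChartAt (𝓡 d) p x) t) ∧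
        F (extChartAt (𝓡 d) p x) t ∈ (extChartAt (𝓡 d) p).target ∧
        HasDerivAt (F (extChartAt (𝓡 d) p x))
          (chartField v p (F (extChartAt (𝓡 d) p x) t)) t ∧
        HasDerivAt (Y (extChartAt (𝓡 d) p x))
          (fderiv ℝ (chartField v p) (F (extChartAt (𝓡 d) p x) t) ∘L
            Y (extChartAt (𝓡 d) p x) t) t ∧
        HasMFDerivAt (𝓡 d) (𝓡 d) (flowMap v t) x
          (chartSymmDeriv p (F (extChartAt (𝓡 d) p x) t) ∘L
            Y (extChartAt (𝓡 d) p x) t ∘L chartDeriv p x) := by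
  obtain ⟨W, hW, hWs, ε, hε, F, Y, h⟩ := exists_chart_flow hv p
  have hflow : ∀ x ∈ W, ∀ t ∈ Ioo (-ε) ε,
      flowMap v t x = (extChartAt (𝓡 d) p).symm (F (extChartAt (𝓡 d) p x) t) := by
    intro x hx t ht
    obtain ⟨h0, -, hF⟩ := h x hx
    have := flowMap_eq_of_isMIntegralCurveOn hv
      (γ := (extChartAt (𝓡 d) p).symm ∘ F (extChartAt (𝓡 d) p x)) (fun s hs =>
        (hasMFDerivAt_chart_symm_comp (hF s hs).2.1 (hF s hs).1).hasMFDerivWithinAt) ht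
    rwa [Function.comp_apply, h0, (extChartAt (𝓡 d) p).left_inv (hWs hx)] at this
  -- Differentiating at `x` requires the chart formula for the flow on a neighbourhood of `x`.
  refine ⟨interior W, interior_mem_nhds.2 hW, ε, hε, F, Y, fun x hx => ?_⟩
  obtain ⟨h0, h1, hF⟩ := h x (interior_subset hx)
  refine ⟨h0, h1, fun t ht => ?_⟩
  obtain ⟨h2, h3, h4, h5⟩ := hF t ht
  refine ⟨hflow x (interior_subset hx) t ht, h2, h3, h4, ?_⟩
  refine HasMFDerivAt.congr_of_eventuallyEq
    (f := (extChartAt (𝓡 d) p).symm ∘ ((fun z => F z t) ∘ extChartAt (𝓡 d) p)) ?_ ?_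
  · exact (hasMFDerivAt_chart_symm h2).comp x
      (h5.hasMFDerivAt.comp x (hasMFDerivAt_chart (hWs (interior_subset hx))))
  · filter_upwards [isOpen_interior.mem_nhds hx] with y hy
    exact hflow y (interior_subset hy) t ht

theorem mdifferentiable_flowMap (hv : IsCVectorField 2 v) (t : ℝ) :
    MDifferentiable (𝓡 d) (𝓡 d) (flowMap v t) := by
  choose W hW ε hε F Y h using exists_chart_flowMap hv
  obtain ⟨s, -, hs⟩ := isCompact_univ.elim_nhds_subcover W fun p _ => hW p
  obtain ⟨ε₀, hε₀, hle⟩ : ∃ ε₀ > 0, ∀ p ∈ s, ε₀ ≤ ε p := by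
    rcases s.eq_empty_or_nonempty with rfl | hne
    · exact ⟨1, one_pos, by simp⟩
    · obtain ⟨p, hp, hmin⟩ := s.exists_min_image ε hne
      exact ⟨ε p, hε p, hmin⟩
  have hsmall : ∀ t ∈ Ioo (-ε₀) ε₀, MDifferentiable (𝓡 d) (𝓡 d) (flowMap v t) := by
    intro t ht y
    obtain ⟨p, hp, hy⟩ : ∃ p ∈ s, y ∈ W p := by simpa using hs (mem_univ y)
    exact ((h p y hy).2.2 t ⟨by linarith [ht.1, hle p hp],
      by linarith [ht.2, hle p hp]⟩).2.2.2.2.mdifferentiableAt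
  -- Then `t / n` lies in the uniform range of small times, and the flow at time `t` is an `n`-fold
  -- composition.
  obtain ⟨n, hn⟩ := exists_nat_gt (|t| / ε₀)
  have hn0 : (0 : ℝ) < n := (div_nonneg (abs_nonneg t) hε₀.le).trans_lt hn
  have hmul : ∀ k : ℕ, MDifferentiable (𝓡 d) (𝓡 d) (flowMap v (k * (t / n))) := by
    intro k
    induction k with
    | zero =>
      have : flowMap v (((0 : ℕ) : ℝ) * (t / n)) = id := by
        funext x
        simpa using flowMap_zero hv x
      rw [this]
      exact mdifferentiable_id
    | succ k ih =>
      have : flowMap v (((k + 1 : ℕ) : ℝ) * (t / n)) =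
          flowMap v (t / n) ∘ flowMap v (k * (t / n)) := by
        funext x
        rw [Function.comp_apply, ← flowMap_add hv]
        congr 1
        push_cast
        ring
      rw [this]
      refine (hsmall _ (abs_lt.1 ?_)).comp ih
      rw [abs_div, abs_of_pos hn0, div_lt_iff₀ hn0, mul_comm]
      exact (div_lt_iff₀ hε₀).1 hn
  have := hmul n
  rwa [mul_div_cancel₀ t hn0.ne'] at this

end Flow

end

noncomputable section

variable {d : ℕ} {M : Type*} [TopologicalSpace M] [ChartedSpace (EuclideanSpace ℝ (Fin d)) M]
  [IsManifold (𝓡 d) ∞ M]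

/-! ### Gram determinants -/

theorem gramDet_pos (g : Metric d M) (x : M) {b : Fin d → TangentSpace (𝓡 d) x}
    (hb : LinearIndependent ℝ b) : 0 < gramDet g x b := by
  refine Matrix.PosDef.det_pos (Matrix.PosDef.of_dotProduct_mulVec_pos ?_ ?_)
  · ext i j
    simpa using g.symm x _ _
  · intro c hc
    have hne : ∑ i, c i • b i ≠ 0 := fun h =>
      hc (funext fun i => (Fintype.linearIndependent_iff.1 hb) c h i)
    have := g.pos x _ hne
    simp only [map_sum, map_smul, sum_apply, smul_apply,
      smul_eq_mul] at this
    simp only [dotProduct, Matrix.mulVec, Matrix.of_apply, star_trivial]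
    refine this.trans_eq ?_
    simp only [Finset.mul_sum]
    rw [Finset.sum_comm]
    refine Finset.sum_congr rfl fun i _ => Finset.sum_congr rfl fun j _ => ?_
    ring

theorem gramDet_sum_smul (g : Metric d M) (x : M) (b : Fin d → TangentSpace (𝓡 d) x)
    (B : Matrix (Fin d) (Fin d) ℝ) :
    gramDet g x (fun i => ∑ k, B k i • b k) = B.det ^ 2 * gramDet g x b := by
  have : (Matrix.of fun i j => g.inner x (∑ k, B k i • b k) (∑ k, B k j • b k)) =
      B.transpose * (Matrix.of fun i j => g.inner x (b i) (b j)) * B := by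
    ext i j
    simp only [map_sum, map_smul, sum_apply, smul_apply,
      smul_eq_mul, Matrix.of_apply, Matrix.mul_apply, Matrix.transpose_apply, Finset.sum_mul,
      Finset.mul_sum]
    refine Finset.sum_congr rfl fun k _ => Finset.sum_congr rfl fun l _ => ?_
    ring
  rw [gramDet, this, Matrix.det_mul, Matrix.det_mul, Matrix.det_transpose, gramDet]
  ring

theorem sum_smul_stdVec (u : EuclideanSpace ℝ (Fin d)) : ∑ i, u i • stdVec i = u := by
  ext j
  simp [stdVec, Finset.sum_apply, Pi.single_apply]

theorem linearIndependent_stdVec : LinearIndependent ℝ (stdVec : Fin d → EuclideanSpace ℝ (Fin d)) := by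
  rw [Fintype.linearIndependent_iff]
  intro c hc i
  have := congrFun (congrArg WithLp.ofLp hc) i
  simpa [stdVec, Finset.sum_apply, Pi.single_apply] using this

theorem linearIndependent_coordVec {p : M} {z : EuclideanSpace ℝ (Fin d)}
    (hz : z ∈ (extChartAt (𝓡 d) p).target) :
    LinearIndependent ℝ (coordVec p z : Fin d → EuclideanSpace ℝ (Fin d)) := by
  refine linearIndependent_stdVec.map' (chartSymmDeriv p z).toLinearMap (LinearMap.ker_eq_bot.2 ?_)
  exact Function.LeftInverse.injective (chartDeriv_chartSymmDeriv hz)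

theorem volDensity_pos (g : Metric d M) {p : M} {z : EuclideanSpace ℝ (Fin d)}
    (hz : z ∈ (extChartAt (𝓡 d) p).target) : 0 < volDensity g p z :=
  Real.sqrt_pos.2 (gramDet_pos g _ (linearIndependent_coordVec hz))

/-- The parallelotope volume of tangent vectors, computed in a chart. -/
theorem sqrt_gramDet_eq (g : Metric d M) {p : M} {z : EuclideanSpace ℝ (Fin d)}
    (hz : z ∈ (extChartAt (𝓡 d) p).target) (b : Fin d → EuclideanSpace ℝ (Fin d)) :
    √(gramDet g ((extChartAt (𝓡 d) p).symm z) b) =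
      |(Matrix.of fun k i => chartDeriv p ((extChartAt (𝓡 d) p).symm z) (b i) k).det| *
        volDensity g p z := by
  set B : Matrix (Fin d) (Fin d) ℝ :=
    Matrix.of fun k i => chartDeriv p ((extChartAt (𝓡 d) p).symm z) (b i) k with hB
  have hb : b = fun i => ∑ k, B k i • chartSymmDeriv p z (stdVec k) := by
    funext i
    conv_lhs => rw [← chartSymmDeriv_chartDeriv hz (b i), ← sum_smul_stdVec (chartDeriv p _ (b i))]
    rw [map_sum]
    exact Finset.sum_congr rfl fun k _ => map_smul _ _ _
  have := gramDet_sum_smul g ((extChartAt (𝓡 d) p).symm z) (coordVec p z) B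
  have h2 : gramDet g ((extChartAt (𝓡 d) p).symm z) b =
      B.det ^ 2 * gramDet g ((extChartAt (𝓡 d) p).symm z) (coordVec p z) :=
    (congrArg (gramDet g ((extChartAt (𝓡 d) p).symm z)) hb).trans this
  rw [h2, Real.sqrt_mul (sq_nonneg _), Real.sqrt_sq_eq_abs, volDensity]

/-- The coordinate fields are C¹ sections because the chart makes them constant, so the metric
coefficients are C¹ at the chart's centre. Their determinant is positive there, away from the
singularity of the square root. -/
theorem differentiableAt_volDensity (g : Metric d M) (p : M) :
    DifferentiableAt ℝ (volDensity g p) (extChartAt (𝓡 d) p p) := by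
  have hM : IsManifold (𝓡 d) 1 M := isManifold_one
  have hz₀ := mem_extChartAt_target (I := 𝓡 d) p
  have hsec : ∀ i : Fin d, ContMDiffAt (𝓡 d) (𝓡 d).tangent 1 (fun x => (⟨x,
      (chartSymmDeriv p (extChartAt (𝓡 d) p x) (stdVec i) : EuclideanSpace ℝ (Fin d))⟩ :
        TangentBundle (𝓡 d) M)) p := by
    intro i
    rw [contMDiffAt_chartDeriv_apply (v := fun x =>
      (chartSymmDeriv p (extChartAt (𝓡 d) p x) (stdVec i) : EuclideanSpace ℝ (Fin d)))]
    refine (contMDiffAt_const (c := (stdVec i : EuclideanSpace ℝ (Fin d)))).congr_of_eventuallyEq ?_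
    filter_upwards [extChartAt_source_mem_nhds (I := 𝓡 d) p] with x hx
    have := chartDeriv_chartSymmDeriv ((extChartAt (𝓡 d) p).map_source hx) (stdVec i)
    rwa [(extChartAt (𝓡 d) p).left_inv hx] at this
  have hentry : ∀ i j : Fin d, DifferentiableAt ℝ (fun z =>
      g.inner ((extChartAt (𝓡 d) p).symm z) (coordVec p z i) (coordVec p z j))
      (extChartAt (𝓡 d) p p) := by
    intro i j
    have h1 : ContMDiffAt (𝓡 d) ((𝓡 d).prod 𝓘(ℝ, ℝ)) 1 (fun x =>
        Bundle.TotalSpace.mk' ℝ (E := Bundle.Trivial M ℝ) x (g.inner x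
          (chartSymmDeriv p (extChartAt (𝓡 d) p x) (stdVec i) : EuclideanSpace ℝ (Fin d))
          (chartSymmDeriv p (extChartAt (𝓡 d) p x) (stdVec j) : EuclideanSpace ℝ (Fin d)))) p :=
      ContMDiffAt.clm_bundle_apply₂ (F₁ := EuclideanSpace ℝ (Fin d))
        (F₂ := EuclideanSpace ℝ (Fin d)) ((g.contMDiff.of_le (by simp)).contMDiffAt)
        (hsec i) (hsec j)
    have h2 := (Bundle.contMDiffAt_section (F := ℝ) (E := Bundle.Trivial M ℝ) p).1 h1
    have h3 : ContMDiffAt 𝓘(ℝ, EuclideanSpace ℝ (Fin d)) (𝓡 d) 1 (extChartAt (𝓡 d) p).symm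
        (extChartAt (𝓡 d) p p) :=
      (contMDiffOn_extChartAt_symm p).contMDiffAt (extChartAt_target_mem_nhds p)
    have h4 := (ContMDiffAt.comp_of_eq h2 h3 (extChartAt_to_inv p)).contDiffAt
    refine (h4.differentiableAt one_ne_zero).congr_of_eventuallyEq ?_
    filter_upwards [extChartAt_target_mem_nhds (I := 𝓡 d) p] with z hz
    simp only [Function.comp_apply, (extChartAt (𝓡 d) p).right_inv hz]
    rfl
  have hdet : DifferentiableAt ℝ (fun z => gramDet g ((extChartAt (𝓡 d) p).symm z) (coordVec p z))
      (extChartAt (𝓡 d) p p) := by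
    simp only [gramDet, Matrix.det_apply, Matrix.of_apply]
    refine DifferentiableAt.fun_sum fun σ _ => DifferentiableAt.const_smul ?_ _
    exact (HasFDerivAt.finsetProd (u := Finset.univ) fun i _ =>
      (hentry (σ i) i).hasFDerivAt).differentiableAt
  exact hdet.sqrt (gramDet_pos g _ (linearIndependent_coordVec hz₀)).ne'

/-! ### The divergence -/

omit [IsManifold (𝓡 d) ∞ M] in
theorem component_eq (v : ∀ x : M, TangentSpace (𝓡 d) x) (p : M) (i : Fin d) :
    component v p i = fun z => chartField v p z i := rfl

theorem differentiableAt_chartField {v : ∀ x : M, TangentSpace (𝓡 d) x} (hv : IsCVectorField 2 v)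
    (p : M) : DifferentiableAt ℝ (chartField v p) (extChartAt (𝓡 d) p p) :=
  (contDiffAt_chartField (by norm_cast) hv p).differentiableAt (by simp)

theorem differentiableAt_chartField_apply {v : ∀ x : M, TangentSpace (𝓡 d) x}
    (hv : IsCVectorField 2 v) (p : M) (i : Fin d) :
    DifferentiableAt ℝ (fun z => chartField v p z i) (extChartAt (𝓡 d) p p) :=
  (differentiableAt_euclidean.1 (differentiableAt_chartField hv p)) i

theorem volDensity_mul_divergence (g : Metric d M) {v : ∀ x : M, TangentSpace (𝓡 d) x}
    (hv : IsCVectorField 2 v) (p : M) :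
    volDensity g p (extChartAt (𝓡 d) p p) * divergence g v p =
      fderiv ℝ (volDensity g p) (extChartAt (𝓡 d) p p) (chartField v p (extChartAt (𝓡 d) p p)) +
      volDensity g p (extChartAt (𝓡 d) p p) *
        ∑ i, fderiv ℝ (chartField v p) (extChartAt (𝓡 d) p p) (stdVec i) i := by
  have hvol := differentiableAt_volDensity g p
  have hpos := volDensity_pos g (mem_extChartAt_target (I := 𝓡 d) p)
  rw [divergence, mul_inv_cancel_left₀ hpos.ne']
  conv_rhs => rw [← sum_smul_stdVec (chartField v p (extChartAt (𝓡 d) p p))]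
  rw [map_sum, Finset.mul_sum, ← Finset.sum_add_distrib]
  refine Finset.sum_congr rfl fun i _ => ?_
  have hi := differentiableAt_chartField_apply hv p i
  have hcomp : fderiv ℝ (fun z => chartField v p z i) (extChartAt (𝓡 d) p p) (stdVec i) =
      fderiv ℝ (chartField v p) (extChartAt (𝓡 d) p p) (stdVec i) i := by
    have := ((EuclideanSpace.proj i : EuclideanSpace ℝ (Fin d) →L[ℝ] ℝ).hasFDerivAt.comp
      (extChartAt (𝓡 d) p p) (differentiableAt_chartField hv p).hasFDerivAt).fderiv
    exact DFunLike.congr_fun this (stdVec i)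
  simp only [component_eq]
  rw [fderiv_fun_mul hvol hi]
  simp only [add_apply, smul_apply, smul_eq_mul, map_smul,
    hcomp]
  ring

/-- The differential of a real function, as a continuous linear form. -/
def realDeriv (f : M → ℝ) (x : M) : EuclideanSpace ℝ (Fin d) →L[ℝ] ℝ :=
  mfderiv (𝓡 d) 𝓘(ℝ, ℝ) f x

theorem divergence_smul (g : Metric d M) {v : ∀ x : M, TangentSpace (𝓡 d) x}
    (hv : IsCVectorField 2 v) {f : M → ℝ} {p : M} (hf : MDifferentiableAt (𝓡 d) 𝓘(ℝ, ℝ) f p) :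
    divergence g (fun y => f y • v y) p = f p * divergence g v p + differential f p (v p) := by
  set z₀ := extChartAt (𝓡 d) p p with hz₀
  have htar := mem_extChartAt_target (I := 𝓡 d) p
  have hinv : (extChartAt (𝓡 d) p).symm z₀ = p := extChartAt_to_inv p
  have hvol := differentiableAt_volDensity g p
  have hpos := volDensity_pos g htar
  have hf' : HasFDerivAt (f ∘ (extChartAt (𝓡 d) p).symm)
      (realDeriv f p ∘L chartSymmDeriv p z₀) z₀ := by
    apply HasMFDerivAt.hasFDerivAt
    have h1 : HasMFDerivAt (𝓡 d) 𝓘(ℝ, ℝ) f ((extChartAt (𝓡 d) p).symm z₀)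
      (realDeriv f p) := by
      rw [hinv]
      exact hf.hasMFDerivAt
    exact h1.comp z₀ (hasMFDerivAt_chart_symm htar)
  have hcomp : ∀ i z, component (fun y => f y • v y) p i z =
      (f ∘ (extChartAt (𝓡 d) p).symm) z * chartField v p z i := fun i z => by
    rw [component_eq]
    have : chartField (fun y => f y • v y) p z =
        f ((extChartAt (𝓡 d) p).symm z) • chartField v p z := map_smul (chartDeriv p _) _ _
    simp only [this, PiLp.smul_apply, smul_eq_mul, Function.comp_apply]
  have hdiff : differential f p (v p) =
      fderiv ℝ (f ∘ (extChartAt (𝓡 d) p).symm) z₀ (chartField v p z₀) := by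
    rw [hf'.fderiv]
    have := chartSymmDeriv_chartDeriv htar (v ((extChartAt (𝓡 d) p).symm z₀))
    have h2 : chartSymmDeriv p z₀ (chartField v p z₀) = v p := this.trans (by rw [hinv])
    exact (congrArg (realDeriv f p) h2).symm
  rw [hdiff, ← sum_smul_stdVec (chartField v p z₀), map_sum, divergence, divergence,
    ← mul_right_inj' hpos.ne', mul_inv_cancel_left₀ hpos.ne', mul_add, ← mul_assoc,
    mul_comm _ (f p), mul_assoc, mul_inv_cancel_left₀ hpos.ne', Finset.mul_sum, Finset.mul_sum,
    ← Finset.sum_add_distrib]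
  refine Finset.sum_congr rfl fun i _ => ?_
  have hi := differentiableAt_chartField_apply hv p i
  -- Keeping `√G vⁱ` as one factor makes the product rule return the summands of `div v` unchanged.
  have hprod : (fun z => volDensity g p z * component (fun y => f y • v y) p i z) =
      fun z => (f ∘ (extChartAt (𝓡 d) p).symm) z * (volDensity g p z * chartField v p z i) := by
    funext z
    rw [hcomp]
    ring
  rw [hprod, fderiv_fun_mul hf'.differentiableAt (hvol.fun_mul hi)]
  simp only [add_apply, smul_apply, smul_eq_mul, map_smul,
    component_eq, Function.comp_apply]
  rw [← hz₀, hinv]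
  ring

/-! ### The volume stretched by a flow -/

/-- The volume of the image under `d (f_t)_x` of the parallelotope spanned by `b`. -/
def volStretch (g : Metric d M) (v : ∀ x : M, TangentSpace (𝓡 d) x) (x : M)
    (b : Fin d → TangentSpace (𝓡 d) x) (t : ℝ) : ℝ :=
  √(gramDet g (flowMap v t x) fun i => mfderiv (𝓡 d) (𝓡 d) (flowMap v t) x (b i))

variable [CompactSpace M] [T2Space M] {v : ∀ x : M, TangentSpace (𝓡 d) x}

/-- The cocycle law moves a derivative at any time to time zero at the point reached. There the
chart centred at that point applies, the one in which `divergence` is computed. -/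
theorem volStretch_add (g : Metric d M) (hv : IsCVectorField 2 v) (x : M)
    (b : Fin d → TangentSpace (𝓡 d) x) (s t : ℝ) :
    volStretch g v x b (s + t) = volStretch g v (flowMap v t x)
      (fun i => mfderiv (𝓡 d) (𝓡 d) (flowMap v t) x (b i)) s := by
  have hfun : flowMap v (s + t) = flowMap v s ∘ flowMap v t := funext (flowMap_add hv s t)
  rw [volStretch, hfun, mfderiv_comp x (mdifferentiable_flowMap hv s _)
    (mdifferentiable_flowMap hv t x)]
  rfl

theorem flowMap_neg_comp (hv : IsCVectorField 2 v) (t : ℝ) (x : M) :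
    flowMap v (-t) (flowMap v t x) = x := by
  rw [← flowMap_add hv, neg_add_cancel, flowMap_zero hv]

theorem mfderiv_flowMap_injective (hv : IsCVectorField 2 v) (t : ℝ) (x : M) :
    Function.Injective (mfderiv (𝓡 d) (𝓡 d) (flowMap v t) x) := by
  have h1 : HasMFDerivAt (𝓡 d) (𝓡 d) (flowMap v (-t) ∘ flowMap v t) x
      (ContinuousLinearMap.id ℝ (TangentSpace (𝓡 d) x)) :=
    (hasMFDerivAt_id x).congr_of_eventuallyEq
      (Eventually.of_forall fun y => flowMap_neg_comp hv t y)
  have h2 := (mdifferentiable_flowMap hv (-t) (flowMap v t x)).hasMFDerivAt.comp x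
    (mdifferentiable_flowMap hv t x).hasMFDerivAt
  have h3 := hasMFDerivAt_unique h2 h1
  exact Function.LeftInverse.injective
    (g := mfderiv (𝓡 d) (𝓡 d) (flowMap v (-t)) (flowMap v t x)) fun u => DFunLike.congr_fun h3 u

theorem volStretch_pos (g : Metric d M) (hv : IsCVectorField 2 v) {x : M}
    {b : Fin d → TangentSpace (𝓡 d) x} (hb : LinearIndependent ℝ b) (t : ℝ) :
    0 < volStretch g v x b t :=
  Real.sqrt_pos.2 (gramDet_pos g _ (hb.map'
    (mfderiv (𝓡 d) (𝓡 d) (flowMap v t) x).toLinearMap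
    (LinearMap.ker_eq_bot.2 (mfderiv_flowMap_injective hv t x))))

/-- In the chart at `p` the stretched volume is `|det Y|` times the volume density along the flow,
times a constant. At time zero `Y = 1`, so `det Y` contributes the trace of the derivative of the
field, and the density contributes its derivative along the field. Together these are the
divergence. -/
theorem hasDerivAt_volStretch_zero (g : Metric d M) (hv : IsCVectorField 2 v) (p : M)
    (b : Fin d → TangentSpace (𝓡 d) p) :
    HasDerivAt (volStretch g v p b) (volStretch g v p b 0 * divergence g v p) 0 := by
  obtain ⟨W, hW, ε, hε, F, Y, h⟩ := exists_chart_flowMap hv p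
  obtain ⟨h0, h1, h⟩ := h p (mem_of_mem_nhds hW)
  set z₀ := extChartAt (𝓡 d) p p with hz₀
  set B : Matrix (Fin d) (Fin d) ℝ := Matrix.of fun k i => chartDeriv p p (b i) k with hB
  set A : ℝ → Matrix (Fin d) (Fin d) ℝ := fun t => Matrix.of fun k i => Y z₀ t (stdVec i) k with hA
  have hform : ∀ t ∈ Ioo (-ε) ε, volStretch g v p b t =
      |(A t).det| * |B.det| * volDensity g p (F z₀ t) := by
    intro t ht
    obtain ⟨h2, h3, h4, h5, h6⟩ := h t ht
    have key : ∀ i, chartDeriv p ((extChartAt (𝓡 d) p).symm (F z₀ t))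
        ((chartSymmDeriv p (F z₀ t) ∘L Y z₀ t ∘L chartDeriv p p) (b i)) =
        Y z₀ t (chartDeriv p p (b i)) := fun i => chartDeriv_chartSymmDeriv h3 _
    have hmul : (Matrix.of fun k i => chartDeriv p ((extChartAt (𝓡 d) p).symm (F z₀ t))
        ((chartSymmDeriv p (F z₀ t) ∘L Y z₀ t ∘L chartDeriv p p) (b i)) k) = A t * B := by
      ext k i
      rw [Matrix.of_apply, key, ← sum_smul_stdVec (chartDeriv p p (b i)), map_sum,
        Matrix.mul_apply]
      simp only [map_smul, hA, hB, Matrix.of_apply, WithLp.ofLp_sum, Finset.sum_apply,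
        PiLp.smul_apply, smul_eq_mul]
      exact Finset.sum_congr rfl fun j _ => mul_comm _ _
    have := sqrt_gramDet_eq g h3
      fun i => (chartSymmDeriv p (F z₀ t) ∘L Y z₀ t ∘L chartDeriv p p) (b i)
    rw [hmul, Matrix.det_mul, abs_mul] at this
    rw [volStretch, h6.mfderiv, h2]
    exact this
  have h00 : (0 : ℝ) ∈ Ioo (-ε) ε := ⟨by linarith, hε⟩
  obtain ⟨-, -, h4, h5, -⟩ := h 0 h00
  rw [h0] at h4 h5
  rw [h1] at h5
  have hA0 : A 0 = 1 := by
    ext k i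
    simp [hA, h1, stdVec, Matrix.one_apply]
  have hAderiv : HasDerivAt (fun t => (A t).det)
      (Matrix.of fun k i => fderiv ℝ (chartField v p) z₀ (stdVec i) k).trace 0 := by
    refine hasDerivAt_det_of_eq_one (fun k i => ?_) hA0
    have h6 := h5.clm_apply (hasDerivAt_const (0 : ℝ) (stdVec i : EuclideanSpace ℝ (Fin d)))
    have h7 := (EuclideanSpace.proj k : EuclideanSpace ℝ (Fin d) →L[ℝ] ℝ).hasFDerivAt.comp_hasDerivAt
      (0 : ℝ) h6
    simpa using! h7
  -- Positivity near zero removes the absolute value before differentiating.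
  have hApos : ∀ᶠ t in 𝓝 (0 : ℝ), 0 < (A t).det :=
    hAderiv.continuousAt.eventually_const_lt (by simp [hA0])
  have hvol : HasDerivAt (fun t => volDensity g p (F z₀ t))
      (fderiv ℝ (volDensity g p) z₀ (chartField v p z₀)) 0 := by
    have h6 : HasFDerivAt (volDensity g p) (fderiv ℝ (volDensity g p) z₀) (F z₀ 0) := by
      rw [h0]
      exact (differentiableAt_volDensity g p).hasFDerivAt
    exact h6.comp_hasDerivAt (0 : ℝ) h4
  have hD0 : volStretch g v p b 0 = |B.det| * volDensity g p z₀ := by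
    rw [hform 0 h00, hA0, h0]
    simp
  have hmain := (hAderiv.mul_const |B.det|).mul hvol
  refine (hmain.congr_of_eventuallyEq ?_).congr_deriv ?_
  · filter_upwards [hApos, Ioo_mem_nhds h00.1 h00.2] with t ht ht'
    rw [hform t ht', abs_of_pos ht]
    rfl
  · have hdiv := volDensity_mul_divergence g hv p
    rw [← hz₀] at hdiv
    rw [hD0, mul_assoc |B.det|, hdiv, hA0, h0, Matrix.trace]
    simp only [Matrix.diag_apply, Matrix.of_apply, Matrix.det_one]
    ring

theorem hasDerivAt_volStretch (g : Metric d M) (hv : IsCVectorField 2 v) (x : M)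
    (b : Fin d → TangentSpace (𝓡 d) x) (t : ℝ) :
    HasDerivAt (volStretch g v x b) (volStretch g v x b t * divergence g v (flowMap v t x)) t := by
  have h := hasDerivAt_volStretch_zero g hv (flowMap v t x)
    (fun i => mfderiv (𝓡 d) (𝓡 d) (flowMap v t) x (b i))
  rw [← volStretch_add g hv, zero_add] at h
  have h2 := HasDerivAt.comp_sub_const t t (by rwa [sub_self])
  refine h2.congr_of_eventuallyEq (Eventually.of_forall fun s => ?_)
  simp only [← volStretch_add g hv, sub_add_cancel]

end

noncomputable section

variable {d : ℕ} {M : Type*} [TopologicalSpace M] [ChartedSpace (EuclideanSpace ℝ (Fin d)) M]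

/-! ### Strong solutions along characteristics -/

/-- The equation holds only at interior times; continuity carries the conservation laws to the
endpoints 0 and `T`. -/
theorem eq_of_hasDerivAt_zero {f : ℝ → ℝ} {a b : ℝ} (hab : a ≤ b) (hf : ContinuousOn f (Icc a b))
    (hf' : ∀ t ∈ Ioo a b, HasDerivAt f 0 t) : f b = f a := by
  rcases hab.eq_or_lt with rfl | hlt
  · rfl
  · obtain ⟨c, -, hc⟩ := exists_hasDerivAt_eq_slope f (fun _ => 0) hlt hf hf'
    rw [eq_comm, div_eq_zero_iff, or_iff_left (sub_pos.2 hlt).ne', sub_eq_zero] at hc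
    exact hc

namespace IsStrongSolution

variable {L : (M → ℝ) → M → ℝ} {T : ℝ} {ρ₀ : M → ℝ} {ρ : ℝ → M → ℝ}

theorem contMDiffAt (h : IsStrongSolution d L T ρ₀ ρ) {t : ℝ} (ht : t ∈ Ioo 0 T) (x : M) :
    ContMDiffAt (𝓘(ℝ, ℝ).prod (𝓡 d)) 𝓘(ℝ, ℝ) 1 (fun q : ℝ × M => ρ q.1 q.2) (t, x) :=
  h.2.1.contMDiffAt ((isOpen_Ioo.prod isOpen_univ).mem_nhds ⟨ht, mem_univ x⟩)

theorem mdifferentiableAt (h : IsStrongSolution d L T ρ₀ ρ) {t : ℝ} (ht : t ∈ Ioo 0 T) (x : M) :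
    MDifferentiableAt (𝓡 d) 𝓘(ℝ, ℝ) (ρ t) x :=
  ((h.contMDiffAt ht x).mdifferentiableAt one_ne_zero).comp x
    (mdifferentiableAt_const.prodMk mdifferentiableAt_id)

/-- Chain rule along `r ↦ (r + s, γ r)`, with the time derivative replaced through the equation. The
shift `s` lets a characteristic start at any snapshot time. -/
theorem hasDerivAt_comp (h : IsStrongSolution d L T ρ₀ ρ) {v : ∀ x : M, TangentSpace (𝓡 d) x}
    {γ : ℝ → M} (hγ : IsMIntegralCurve (I := 𝓡 d) γ v) {s t : ℝ} (ht : t + s ∈ Ioo 0 T) :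
    HasDerivAt (fun r => ρ (r + s) (γ r))
      (differential (ρ (t + s)) (γ t) (v (γ t)) - L (ρ (t + s)) (γ t)) t := by
  have h1 := (h.contMDiffAt ht (γ t)).mdifferentiableAt one_ne_zero
  have h2 := ((hasFDerivAt_id (𝕜 := ℝ) t).add_const s).hasMFDerivAt
  obtain ⟨D, hD, hD1⟩ : ∃ D : ℝ →L[ℝ] ℝ, HasMFDerivAt 𝓘(ℝ, ℝ) 𝓘(ℝ, ℝ)
      (fun r => ρ (r + s) (γ r)) t D ∧ D 1 = mfderiv (𝓘(ℝ, ℝ).prod (𝓡 d)) 𝓘(ℝ, ℝ)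
        (fun q : ℝ × M => ρ q.1 q.2) (t + s, γ t)
        (⟨1, v (γ t)⟩ : ℝ × EuclideanSpace ℝ (Fin d)) :=
    ⟨_, HasMFDerivAt.comp t h1.hasMFDerivAt (h2.prodMk (hγ t)), congrArg
      (mfderiv (𝓘(ℝ, ℝ).prod (𝓡 d)) 𝓘(ℝ, ℝ) (fun q : ℝ × M => ρ q.1 q.2) (t + s, γ t))
      (Prod.ext rfl (one_smul ℝ _))⟩
  have hD' : HasFDerivAt (fun r => ρ (r + s) (γ r)) D t := hD.hasFDerivAt
  refine hD'.hasDerivAt.congr_deriv ?_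
  have h4 := mfderiv_prod_eq_add_apply (v := (⟨1, v (γ t)⟩ : ℝ × EuclideanSpace ℝ (Fin d))) h1
  have h5 : mfderiv 𝓘(ℝ, ℝ) 𝓘(ℝ, ℝ) (fun r => ρ r (γ t)) (t + s) (1 : ℝ) =
      deriv (fun r => ρ r (γ t)) (t + s) := by
    rw [mfderiv_eq_fderiv]
    exact fderiv_apply_one_eq_deriv
  have h6 : deriv (fun r => ρ r (γ t)) (t + s) = - L (ρ (t + s)) (γ t) :=
    eq_neg_of_add_eq_zero_left (h.2.2.2 _ ht (γ t))
  rw [sub_eq_neg_add, ← h6, ← h5]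
  exact hD1.trans h4

theorem continuousOn_comp (h : IsStrongSolution d L T ρ₀ ρ) {γ : ℝ → M} (hγ : Continuous γ)
    {s t : ℝ} (hs : 0 ≤ s) (ht : t + s ≤ T) :
    ContinuousOn (fun r => ρ (r + s) (γ r)) (Icc 0 t) := by
  refine h.1.comp (f := fun r => (r + s, γ r)) (by fun_prop) fun r hr =>
    ⟨⟨by linarith [hr.1], by linarith [hr.2]⟩, mem_univ _⟩

variable [IsManifold (𝓡 d) ∞ M] [CompactSpace M] [T2Space M]
  {v : ∀ x : M, TangentSpace (𝓡 d) x} {g : Metric d M}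

theorem advection_apply_flowMap (hv : IsCVectorField 2 v)
    (h : IsStrongSolution d (advectionOp g v) T ρ₀ ρ) {t : ℝ} (ht : t ∈ Icc 0 T) (x : M) :
    ρ t (flowMap v t x) = ρ₀ x := by
  have hγ := isMIntegralCurve_flowMap hv x
  have := eq_of_hasDerivAt_zero (f := fun r => ρ (r + 0) (flowMap v r x)) ht.1
    (h.continuousOn_comp hγ.continuous le_rfl (by simpa using ht.2)) fun r hr => by
      refine (h.hasDerivAt_comp hγ (by simpa using ⟨hr.1, hr.2.trans_le ht.2⟩)).congr_deriv ?_
      rw [advectionOp, inner_grad, sub_self]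
  simpa [flowMap_zero hv, h.2.2.1] using this

/-- Conservation of mass: along a characteristic the logarithmic rates of density and volume are
`-div v` and `div v`. -/
theorem mul_volStretch (hv : IsCVectorField 2 v)
    (h : IsStrongSolution d (continuityOp g v) T ρ₀ ρ) {s t : ℝ} (hs : 0 ≤ s) (ht : 0 ≤ t)
    (hst : t + s ≤ T) (x : M) (b : Fin d → TangentSpace (𝓡 d) x) :
    ρ (t + s) (flowMap v t x) * volStretch g v x b t = ρ s x * volStretch g v x b 0 := by
  have hγ := isMIntegralCurve_flowMap hv x
  have := eq_of_hasDerivAt_zero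
    (f := fun r => ρ (r + s) (flowMap v r x) * volStretch g v x b r) ht
    ((h.continuousOn_comp hγ.continuous hs hst).mul fun r _ =>
      (hasDerivAt_volStretch g hv x b r).continuousAt.continuousWithinAt) fun r hr => by
      have hr' : r + s ∈ Ioo 0 T := ⟨by linarith [hr.1], by linarith [hr.2]⟩
      refine ((h.hasDerivAt_comp hγ hr').mul (hasDerivAt_volStretch g hv x b r)).congr_deriv ?_
      rw [continuityOp, divergence_smul g hv (h.mdifferentiableAt hr' _)]
      ring
  simpa [flowMap_zero hv] using this

theorem pos (hv : IsCVectorField 2 v) (h : IsStrongSolution d (continuityOp g v) T ρ₀ ρ)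
    (h₀ : ∀ x, 0 < ρ₀ x) {t : ℝ} (ht : t ∈ Icc 0 T) (x : M) : 0 < ρ t x := by
  have h1 := h.mul_volStretch hv le_rfl ht.1 (by simpa using ht.2) (flowMap v (-t) x)
    (stdVec : Fin d → EuclideanSpace ℝ (Fin d))
  rw [← flowMap_add hv, add_neg_cancel, flowMap_zero hv, add_zero, h.2.2.1] at h1
  have h2 := fun r => volStretch_pos g hv (x := flowMap v (-t) x) linearIndependent_stdVec r
  exact pos_of_mul_pos_left (h1 ▸ mul_pos (h₀ _) (h2 0)) (h2 t).le

/-- The same volume factor governs the passage from time 0 to `t` and from `s` to `t + s`, since the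
flow is autonomous. Eliminating it leaves a relation between densities alone. -/
theorem mul_eq_mul (hv : IsCVectorField 2 v) (h : IsStrongSolution d (continuityOp g v) T ρ₀ ρ)
    {s t : ℝ} (hs : 0 ≤ s) (ht : 0 ≤ t) (hst : t + s ≤ T) (x : M) :
    ρ t x * ρ s (flowMap v (-t) x) = ρ (t + s) x * ρ₀ (flowMap v (-t) x) := by
  have h1 := h.mul_volStretch hv le_rfl ht (by linarith) (flowMap v (-t) x)
    (stdVec : Fin d → EuclideanSpace ℝ (Fin d))
  have h2 := h.mul_volStretch hv hs ht hst (flowMap v (-t) x)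
    (stdVec : Fin d → EuclideanSpace ℝ (Fin d))
  rw [← flowMap_add hv, add_neg_cancel, flowMap_zero hv] at h1 h2
  rw [add_zero, h.2.2.1] at h1
  have h3 := fun r => volStretch_pos g hv (x := flowMap v (-t) x) linearIndependent_stdVec r
  refine mul_right_cancel₀ (mul_pos (h3 t) (h3 0)).ne' ?_
  linear_combination (ρ s (flowMap v (-t) x) * volStretch g v (flowMap v (-t) x) stdVec 0) * h1 -
    (ρ₀ (flowMap v (-t) x) * volStretch g v (flowMap v (-t) x) stdVec 0) * h2

theorem eq_pushforward (hv : IsCVectorField 2 v)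
    (h : IsStrongSolution d (continuityOp g v) T ρ₀ ρ) {t : ℝ} (ht : t ∈ Icc 0 T)
    (Φ : M ≃ₘ^2⟮𝓡 d, 𝓡 d⟯ M) (hΦ : ⇑Φ = flowMap v t) (x : M) : ρ t x = pushforward g Φ ρ₀ x := by
  set e : Fin d → TangentSpace (𝓡 d) x := fun i => (stdVec i : EuclideanSpace ℝ (Fin d)) with he
  -- With this frame the parallelotope at time `t` is the standard one at `x`, so the ratio of the
  -- volumes at times 0 and `t` is the Jacobian of the inverse map.
  set b : Fin d → TangentSpace (𝓡 d) (Φ.symm x) := fun i =>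
    mfderiv (𝓡 d) (𝓡 d) Φ.symm x (e i) with hb
  have h1 := h.mul_volStretch hv le_rfl ht.1 (by simpa using ht.2) (Φ.symm x) b
  have hΦx : flowMap v t (Φ.symm x) = x := by rw [← hΦ, Φ.apply_symm_apply]
  have hcomp : HasMFDerivAt (𝓡 d) (𝓡 d) (flowMap v t ∘ Φ.symm) x
      (ContinuousLinearMap.id ℝ (TangentSpace (𝓡 d) x)) :=
    (hasMFDerivAt_id x).congr_of_eventuallyEq
      (Eventually.of_forall fun y => by rw [Function.comp_apply, ← hΦ, Φ.apply_symm_apply, id])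
  have hsymm : MDifferentiableAt (𝓡 d) (𝓡 d) Φ.symm x := Φ.symm.mdifferentiable two_ne_zero x
  have hid := hasMFDerivAt_unique
    ((mdifferentiable_flowMap hv t (Φ.symm x)).hasMFDerivAt.comp x hsymm.hasMFDerivAt) hcomp
  have hDt : volStretch g v (Φ.symm x) b t = √(gramDet g x e) := by
    have hbe : (fun i => mfderiv (𝓡 d) (𝓡 d) (flowMap v t) (Φ.symm x) (b i)) = e :=
      funext fun i => DFunLike.congr_fun hid (e i)
    have key : ∀ (y : M) (c : Fin d → EuclideanSpace ℝ (Fin d)), y = x → c = e →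
        √(gramDet g y c) = √(gramDet g x e) := by
      rintro y c rfl rfl
      rfl
    exact key _ _ hΦx hbe
  have hfun : flowMap v 0 = (id : M → M) := funext (flowMap_zero hv)
  have hD0 : volStretch g v (Φ.symm x) b 0 = √(gramDet g (Φ.symm x) b) := by
    rw [volStretch, hfun, mfderiv_id]
    rfl
  have hpos := gramDet_pos g x (b := e) linearIndependent_stdVec
  rw [hΦx, add_zero, h.2.2.1, hDt, hD0] at h1
  rw [pushforward, absJacobian, Real.sqrt_div' _ hpos.le, mul_div_assoc',
    eq_div_iff (Real.sqrt_pos.2 hpos).ne']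
  exact h1

end IsStrongSolution

/-! ### Recovering the flow and the vector field from delay maps -/

section Delay

variable [IsManifold (𝓡 d) ∞ M] [CompactSpace M] [T2Space M]
  {v w : ∀ x : M, TangentSpace (𝓡 d) x} {y : M → ℝ} {Δt : ℝ}

theorem flowMap_iterate (hv : IsCVectorField 2 v) (t : ℝ) (n : ℕ) (x : M) :
    (flowMap v t)^[n] x = flowMap v (n * t) x := by
  induction n with
  | zero => simp [flowMap_zero hv]
  | succ n ih =>
    rw [Function.iterate_succ_apply', ih, ← flowMap_add hv]
    congr 1
    push_cast
    ring

theorem delayMap_flowMap_apply (hv : IsCVectorField 2 v) (x : M) (i : Fin (2 * d + 1)) :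
    delayMap (2 * d + 1) y (flowMap v Δt) (flowMap v (-((2 * d : ℕ) * Δt)) x) i =
      y (flowMap v (-((2 * d - i : ℕ) * Δt)) x) := by
  have hi : (i : ℕ) ≤ 2 * d := Nat.lt_succ_iff.1 i.2
  simp only [delayMap, flowMap_iterate hv, ← flowMap_add hv]
  congr 2
  rw [Nat.cast_sub hi]
  ring

/-- Only the delay map of `v` is needed: the hypothesis exchanges the backward flow of `v` for that
of `w` inside `y`. The exchange followed by one more backward step of `w` reaches time `(2d+1)Δt`,
hence the range of `j`. -/
theorem flowMap_eq_of_delay (hv : IsCVectorField 2 v) (hw : IsCVectorField 2 w)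
    (hinj : Function.Injective (delayMap (2 * d + 1) y (flowMap v Δt)))
    (h : ∀ j : ℕ, j ≤ 2 * d + 1 → ∀ x,
      y (flowMap v (-(j * Δt)) x) = y (flowMap w (-(j * Δt)) x)) (x : M) :
    flowMap v Δt x = flowMap w Δt x := by
  have key : ∀ z, flowMap v (-Δt) z = flowMap w (-Δt) z := by
    intro z
    have h1 : flowMap v (-((2 * d : ℕ) * Δt)) (flowMap v (-Δt) z) =
        flowMap v (-((2 * d : ℕ) * Δt)) (flowMap w (-Δt) z) := by
      refine hinj (PiLp.ext fun i => ?_)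
      rw [delayMap_flowMap_apply hv, delayMap_flowMap_apply hv, h _ (by omega) (flowMap w _ z),
        ← flowMap_add hv, ← flowMap_add hw]
      have := h (2 * d - i + 1) (by omega) z
      convert this using 3 <;> push_cast <;> ring
    have h2 := congrArg (flowMap v ((2 * d : ℕ) * Δt)) h1
    rwa [← flowMap_add hv, ← flowMap_add hv _ _ (flowMap w _ z), add_neg_cancel, flowMap_zero hv,
      flowMap_zero hv] at h2
  -- The backward maps agree; applying this at `flowMap w Δt x` inverts both.
  have h3 := congrArg (flowMap v Δt) (key (flowMap w Δt x))
  rwa [flowMap_neg_comp hw, ← flowMap_add hv, add_neg_cancel, flowMap_zero hv, eq_comm] at h3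

/-- The functions in the hypothesis are the coordinates of the delay map composed with a backward
flow, and that composition is an immersion. -/
theorem eq_zero_of_delay (hv : IsCVectorField 2 v)
    (hemb : IsC1Embedding d (delayMap (2 * d + 1) y (flowMap v Δt))) {x : M}
    {u : TangentSpace (𝓡 d) x}
    (h : ∀ j : ℕ, j ≤ 2 * d → differential (fun z => y (flowMap v (-(j * Δt)) z)) x u = 0) :
    u = 0 := by
  set f := flowMap v (-((2 * d : ℕ) * Δt)) with hf
  have h1 := (hemb.1.mdifferentiable one_ne_zero (f x)).hasMFDerivAt.comp x
    (mdifferentiable_flowMap hv (-((2 * d : ℕ) * Δt)) x).hasMFDerivAt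
  refine mfderiv_flowMap_injective hv (-((2 * d : ℕ) * Δt)) x (hemb.2.2.1 _ ?_)
  rw [map_zero, map_zero]
  refine PiLp.ext fun i => ?_
  have h2 := (EuclideanSpace.proj i : EuclideanSpace ℝ (Fin (2 * d + 1)) →L[ℝ] ℝ).hasFDerivAt
    (x := (delayMap (2 * d + 1) y (flowMap v Δt) ∘ f) x)
  have h3 := (h2.hasMFDerivAt.comp x h1).mfderiv
  have h4 : (EuclideanSpace.proj i : EuclideanSpace ℝ (Fin (2 * d + 1)) →L[ℝ] ℝ) ∘
      (delayMap (2 * d + 1) y (flowMap v Δt) ∘ f) =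
      fun z => y (flowMap v (-((2 * d - i : ℕ) * Δt)) z) :=
    funext fun z => delayMap_flowMap_apply hv z i
  rw [h4] at h3
  have h5 := h (2 * d - i) (by omega)
  exact (DFunLike.congr_fun h3 u).symm.trans h5

end Delay

end

/-! ### Inversion for the advection and continuity equations -/

section Inversion

variable {d : ℕ} {M : Type*} [TopologicalSpace M] [ChartedSpace (EuclideanSpace ℝ (Fin d)) M]
  [IsManifold (𝓡 d) ∞ M] [CompactSpace M] [T2Space M] {g : Metric d M}
  {v w : ∀ x : M, TangentSpace (𝓡 d) x} {m : ℕ} {T Δt : ℝ} {ρ₀ : M → ℝ} {ρv ρw : ℝ → M → ℝ}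

theorem advection_inversion (hv : IsCVectorField 2 v) (hw : IsCVectorField 2 w)
    (hm : 2 * d + 1 < m) (hΔt : 0 < Δt) (hT : m * Δt ≤ T)
    (hG : (ρ₀, flowMap v Δt) ∈ takensSet d M)
    (hρv : IsStrongSolution d (advectionOp g v) T ρ₀ ρv)
    (hρw : IsStrongSolution d (advectionOp g w) T ρ₀ ρw)
    (hsnap : ∀ j : ℕ, j ≤ m → ∀ x : M, ρv (j * Δt) x = ρw (j * Δt) x) :
    (∀ x : M, flowMap v Δt x = flowMap w Δt x) ∧
      ((∀ j : ℕ, j < m → ∀ x : M,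
        advectionOp g v (ρv (j * Δt)) x = advectionOp g w (ρw (j * Δt)) x) → ∀ x : M, v x = w x) := by
  have htime : ∀ j : ℕ, j ≤ m → (j * Δt : ℝ) ∈ Icc 0 T := fun j hj =>
    ⟨by positivity, le_trans (by gcongr) hT⟩
  have hpull : ∀ {u : ∀ x : M, TangentSpace (𝓡 d) x} {ρ : ℝ → M → ℝ} (_ : IsCVectorField 2 u)
      (_ : IsStrongSolution d (advectionOp g u) T ρ₀ ρ) (j : ℕ) (_ : j ≤ m) (x : M),
      ρ (j * Δt) x = ρ₀ (flowMap u (-(j * Δt)) x) := by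
    intro u ρ hu hρ j hj x
    have := hρ.advection_apply_flowMap hu (htime j hj) (flowMap u (-(j * Δt)) x)
    rwa [← flowMap_add hu, add_neg_cancel, flowMap_zero hu] at this
  refine ⟨flowMap_eq_of_delay (y := ρ₀) hv hw hG.2.2.2.1 fun j hj x => ?_, fun hL x => ?_⟩
  · rw [← hpull hv hρv j (by omega), ← hpull hw hρw j (by omega), hsnap j (by omega)]
  · rw [← sub_eq_zero]
    refine eq_zero_of_delay (y := ρ₀) hv hG.2.2 fun j hj => ?_
    have h1 := hL j (by omega) x
    rw [show ρw (j * Δt) = ρv (j * Δt) from funext fun z => (hsnap j (by omega) z).symm,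
      advectionOp, advectionOp, inner_grad, inner_grad] at h1
    rw [map_sub, ← funext (hpull hv hρv j (by omega)), h1, sub_self]

theorem continuity_inversion [MeasurableSpace M] (hv : IsCVectorField 2 v)
    (hw : IsCVectorField 2 w) (hm : 2 * d + 1 < m) (hΔt : 0 < Δt) (hT : m * Δt ≤ T)
    (hA : SatisfiesAssumption g ρ₀ (flowMap v Δt))
    (hρv : IsStrongSolution d (continuityOp g v) T ρ₀ ρv)
    (hρw : IsStrongSolution d (continuityOp g w) T ρ₀ ρw)
    (hsnap : ∀ j : ℕ, j ≤ m → ∀ x : M, ρv (j * Δt) x = ρw (j * Δt) x) :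
    (∀ x : M, flowMap v Δt x = flowMap w Δt x) ∧
      ((∀ j : ℕ, j < m → ∀ x : M,
        continuityOp g v (ρv (j * Δt)) x = continuityOp g w (ρw (j * Δt)) x) →
        ∀ x : M, v x = w x) := by
  obtain ⟨⟨hC1, hpos, -⟩, Φ, hΦ, hG⟩ := hA
  have htime : ∀ j : ℕ, j ≤ m → (j * Δt : ℝ) ∈ Icc 0 T := fun j hj =>
    ⟨by positivity, le_trans (by gcongr) hT⟩
  have hΔtT : Δt ∈ Icc 0 T := by simpa using htime 1 (by omega)
  -- Agreement at time `Δt` gives both solutions the same observable `y`.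
  have hone : ∀ x, ρv Δt x = ρw Δt x := by simpa using hsnap 1 (by omega)
  set y : M → ℝ := fun x => ρ₀ x / pushforward g Φ ρ₀ x with hy
  have hyv : ∀ x, y x = ρ₀ x / ρv Δt x := fun x => by
    rw [hρv.eq_pushforward hv hΔtT Φ hΦ]
  have hratio : ∀ {u : ∀ x : M, TangentSpace (𝓡 d) x} {ρ : ℝ → M → ℝ} (_ : IsCVectorField 2 u)
      (_ : IsStrongSolution d (continuityOp g u) T ρ₀ ρ) (_ : ∀ x, ρv Δt x = ρ Δt x)
      (j : ℕ) (_ : j + 1 ≤ m) (x : M),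
      ρ (j * Δt) x = y (flowMap u (-(j * Δt)) x) * ρ ((j + 1 : ℕ) * Δt) x := by
    intro u ρ hu hρ h1 j hj x
    have hsum : (j * Δt + Δt : ℝ) = (j + 1 : ℕ) * Δt := by push_cast; ring
    have := hρ.mul_eq_mul hu hΔt.le (htime j (by omega)).1 (hsum ▸ (htime (j + 1) hj).2) x
    rw [hyv, h1, div_mul_eq_mul_div, eq_div_iff (hρ.pos hu hpos hΔtT _).ne', this, hsum, mul_comm]
  refine ⟨flowMap_eq_of_delay (y := y) hv hw hG.2.2.2.1 fun j hj x => ?_, fun hL x => ?_⟩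
  · have h1 := hratio hv hρv (fun _ => rfl) j (by omega) x
    have h2 := hratio hw hρw hone j (by omega) x
    rw [← hsnap j (by omega), ← hsnap (j + 1) (by omega), h1] at h2
    exact mul_right_cancel₀ (hρv.pos hv hpos (htime (j + 1) (by omega)) x).ne' h2
  · have hdiff : ∀ j : ℕ, j < m → MDifferentiableAt (𝓡 d) 𝓘(ℝ, ℝ) (ρv (j * Δt)) x := by
      intro j hj
      -- Time 0 lies outside the open interval on which the solution is C¹, so there the regularity
      -- of `ρ₀` is used. For later snapshots `j < m` keeps the time strictly below `T`.
      rcases j.eq_zero_or_pos with rfl | hj0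
      · have : ρv ((0 : ℕ) * Δt) = ρ₀ := funext fun z => by simpa using hρv.2.2.1 z
        rw [this]
        exact hC1.mdifferentiable one_ne_zero x
      · refine hρv.mdifferentiableAt ⟨by positivity, lt_of_lt_of_le ?_ hT⟩ x
        gcongr
    have hlin : ∀ j : ℕ, j < m → ρv (j * Δt) x * (divergence g v x - divergence g w x) +
        differential (ρv (j * Δt)) x (v x - w x) = 0 := by
      intro j hj
      have h1 := hL j hj x
      rw [show ρw (j * Δt) = ρv (j * Δt) from funext fun z => (hsnap j hj.le z).symm,
        continuityOp, continuityOp, divergence_smul g hv (hdiff j hj),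
        divergence_smul g hw (hdiff j hj)] at h1
      rw [map_sub]
      linear_combination h1
    rw [← sub_eq_zero]
    refine eq_zero_of_delay (y := y) hv hG.2.2 fun j hj => ?_
    set R : M → ℝ := fun z => y (flowMap v (-(j * Δt)) z) with hR
    have hRd : MDifferentiableAt (𝓡 d) 𝓘(ℝ, ℝ) R x :=
      (hG.1.mdifferentiable one_ne_zero _).comp x (mdifferentiable_flowMap hv _ x)
    have hprod : ρv (j * Δt) = R * ρv ((j + 1 : ℕ) * Δt) :=
      funext fun z => hratio hv hρv (fun _ => rfl) j (by omega) z
    have hmul : differential (ρv (j * Δt)) x (v x - w x) =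
        R x * differential (ρv ((j + 1 : ℕ) * Δt)) x (v x - w x) +
          ρv ((j + 1 : ℕ) * Δt) x * differential R x (v x - w x) := by
      have := (hRd.hasMFDerivAt.mul (hdiff (j + 1) (by omega)).hasMFDerivAt).mfderiv
      rw [← hprod] at this
      exact DFunLike.congr_fun this (v x - w x)
    have h1 := hlin j (by omega)
    have h2 := hlin (j + 1) (by omega)
    have h3 := congrFun hprod x
    rw [Pi.mul_apply] at h3
    rw [hmul, h3] at h1
    refine (mul_eq_zero.1 ?_).resolve_left
      (hρv.pos hv hpos (htime (j + 1) (by omega)) x).ne'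
    -- Subtracting `R x` times the relation at `j + 1` from that at `j` cancels the divergences and
    -- leaves `ρ dR(v - w) = 0`, with `ρ > 0` the snapshot at `j + 1`.
    linear_combination h1 - R x * h2

end Inversion

end SnapshotInversion

theorem mainTheorem6 {d : ℕ} {M : Type*} [TopologicalSpace M] [CompactSpace M] [T2Space M]
    [MeasurableSpace M] [BorelSpace M]
    [ChartedSpace (EuclideanSpace ℝ (Fin d)) M] [IsManifold (𝓡 d) ∞ M]
    (g : SnapshotInversion.Metric d M)
    (v w : ∀ x : M, TangentSpace (𝓡 d) x)
    (hv : SnapshotInversion.IsCVectorField 2 v) (hw : SnapshotInversion.IsCVectorField 2 w)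
    (m : ℕ) (hm : 2 * d + 1 < m)
    (T Δt : ℝ) (hΔt : 0 < Δt) (hT : m * Δt ≤ T)
    (ρ₀ : M → ℝ) (ρv ρw : ℝ → M → ℝ)
    (L : (∀ x : M, TangentSpace (𝓡 d) x) → (M → ℝ) → M → ℝ)
    (hL : (L = SnapshotInversion.continuityOp g ∧
        SnapshotInversion.SatisfiesAssumption g ρ₀ (SnapshotInversion.flowMap v Δt)) ∨
      (L = SnapshotInversion.advectionOp g ∧
        (ρ₀, SnapshotInversion.flowMap v Δt) ∈ SnapshotInversion.takensSet d M))
    (hρv : SnapshotInversion.IsStrongSolution d (L v) T ρ₀ ρv)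
    (hρw : SnapshotInversion.IsStrongSolution d (L w) T ρ₀ ρw)
    (hsnap : ∀ j : ℕ, j ≤ m → ∀ x : M, ρv (j * Δt) x = ρw (j * Δt) x) :
    (∀ x : M, SnapshotInversion.flowMap v Δt x = SnapshotInversion.flowMap w Δt x) ∧
      ((∀ j : ℕ, j < m → ∀ x : M, L v (ρv (j * Δt)) x = L w (ρw (j * Δt)) x) →
        ∀ x : M, v x = w x) := by
  rcases hL with ⟨rfl, hA⟩ | ⟨rfl, hG⟩
  · exact SnapshotInversion.continuity_inversion hv hw hm hΔt hT hA hρv hρw hsnap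
  · exact SnapshotInversion.advection_inversion hv hw hm hΔt hT hG hρv hρw hsnap
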